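/- Let Regular$^2$ be the following matrix constraint. An instance consists of an $R\times C$ matrix of variables $M_{r,c}$, each with a finite domain $D_{r,c}\subseteq V$ in a finite value set $V$; of a (complete) DFA over $V$ with $|Q|$ states for each row; and of a DFA over $V$ with $|Q'|$ states for each column. An assignment satisfies the constraint if every row, read from left to right, is accepted by its row automaton and every column, read from top to bottom, is accepted by its column automaton. Domains are domain consistent (DC) if each value $v$ in the domain of each variable $M_{r,c}$ has a support, i.e. there is a satisfying assignment that takes all its values from these domains and has $M_{r,c}=v$. Enforcing DC means to compute the largest subdomains $D'_{r,c}\subseteq D_{r,c}$ that are domain consistent (all domains are empty if no satisfying assignment within the given domains exists and $R,C\ge 1$). \textbf{Theorem.} Enforcing DC on Regular$^2$ is fixed-parameter tractable in $k=\lceil C\cdot|Q|\cdot\log_2|Q'|\rceil$. That is, there are one algorithm (a random access program whose arithmetic consists of unit-cost addition and truncated subtraction), a computable function $f:\mathbb N\to\mathbb N$ and a polynomial $p$ such that on every instance, given by its dimensions, the tables of all automata and the lists of domain bits, of total bit length $n$, the algorithm outputs the domains that result from enforcing DC, after at most $f(k)\cdot p(n)$ steps. (If $C=0$, $k$ is read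 as $0$.) -/

import Mathlib

/-! ### Machine model: random access programs with a step count

A state consists of scalar registers and of finitely many used random access arrays, all of them
holding natural numbers. Programs are finite; the only arithmetic is addition and truncated
subtraction (no multiplication), charged at unit cost. -/

namespace RAM

/-- A machine state: `reg x` is the content of register `x`,
`arr a i` is the content of cell `i` of array `a`. -/
structure State where
  reg : ℕ → ℕ
  arr : ℕ → ℕ → ℕ

/-- Expressions. The name of an array is fixed in the program text, the index is computed. -/
inductive Expr where
  | const (n : ℕ)
  | reg (x : ℕ)
  | load (a : ℕ) (i : Expr)
  | add (e₁ e₂ : Expr)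
  | sub (e₁ e₂ : Expr)

/-- The value of an expression in a state (`sub` is truncated subtraction). -/
def Expr.eval (s : State) : Expr → ℕ
  | .const n => n
  | .reg x => s.reg x
  | .load a i => s.arr a (i.eval s)
  | .add e₁ e₂ => e₁.eval s + e₂.eval s
  | .sub e₁ e₂ => e₁.eval s - e₂.eval s

/-- The number of steps charged for evaluating an expression: its number of nodes. -/
def Expr.cost : Expr → ℕ
  | .const _ => 1
  | .reg _ => 1
  | .load _ i => i.cost + 1
  | .add e₁ e₂ => e₁.cost + e₂.cost + 1
  | .sub e₁ e₂ => e₁.cost + e₂.cost + 1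

/-- Programs. A test `e` succeeds when the value of `e` is nonzero. -/
inductive Prog where
  | nop
  | assign (x : ℕ) (e : Expr)
  | store (a : ℕ) (i e : Expr)
  | seq (p q : Prog)
  | ite (e : Expr) (p q : Prog)
  | loop (e : Expr) (p : Prog)

/-- The state after writing `v` into register `x`. -/
def State.setReg (s : State) (x v : ℕ) : State :=
  { s with reg := Function.update s.reg x v }

/-- The state after writing `v` into cell `i` of array `a`. -/
def State.setArr (s : State) (a i v : ℕ) : State :=
  { s with arr := Function.update s.arr a (Function.update (s.arr a) i v) }

/-- `Exec p s t s'`: started in state `s`, the program `p` halts after exactly `t` steps,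
in state `s'`. -/
inductive Exec : Prog → State → ℕ → State → Prop where
  | nop (s : State) : Exec .nop s 1 s
  | assign (s : State) (x : ℕ) (e : Expr) :
      Exec (.assign x e) s (e.cost + 1) (s.setReg x (e.eval s))
  | store (s : State) (a : ℕ) (i e : Expr) :
      Exec (.store a i e) s (i.cost + e.cost + 1) (s.setArr a (i.eval s) (e.eval s))
  | seq {p q : Prog} {s s₁ s₂ : State} {t₁ t₂ : ℕ} :
      Exec p s t₁ s₁ → Exec q s₁ t₂ s₂ → Exec (.seq p q) s (t₁ + t₂) s₂
  | ite_true {e : Expr} {p q : Prog} {s s₁ : State} {t : ℕ} :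
      e.eval s ≠ 0 → Exec p s t s₁ → Exec (.ite e p q) s (e.cost + 1 + t) s₁
  | ite_false {e : Expr} {p q : Prog} {s s₁ : State} {t : ℕ} :
      e.eval s = 0 → Exec q s t s₁ → Exec (.ite e p q) s (e.cost + 1 + t) s₁
  | loop_done {e : Expr} {p : Prog} {s : State} :
      e.eval s = 0 → Exec (.loop e p) s (e.cost + 1) s
  | loop_step {e : Expr} {p : Prog} {s s₁ s₂ : State} {t₁ t₂ : ℕ} :
      e.eval s ≠ 0 → Exec p s t₁ s₁ → Exec (.loop e p) s₁ t₂ s₂ →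
      Exec (.loop e p) s (e.cost + 1 + t₁ + t₂) s₂

/-- The initial state on input `l`: register `0` holds the length of `l`,
array `0` holds the entries of `l`, everything else is `0`. -/
def init (l : List ℕ) : State where
  reg x := if x = 0 then l.length else 0
  arr a i := if a = 0 then l.getD i 0 else 0

/-- The output of a halting state: register `0` holds its length, array `1` its entries. -/
def output (s : State) : List ℕ :=
  (List.range (s.reg 0)).map (s.arr 1)

/-- The length of an input in bits, with one separator per number. -/
def inputSize (l : List ℕ) : ℕ :=
  (l.map fun n => n.size + 1).sum

/-- Fixed-parameter tractability of the problem "given the instance `x`, encoded as `enc x`, compute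
some `y` with `spec x y`" with respect to the parameter `param`: one program solves all instances,
within `f (param x) * poly (size of x)` steps, for a computable `f` and a polynomial `poly`. -/
def FixedParameterTractable {ι : Type*} (enc : ι → List ℕ) (param : ι → ℕ)
    (spec : ι → List ℕ → Prop) : Prop :=
  ∃ (p : Prog) (f : ℕ → ℕ) (poly : Polynomial ℕ), Computable f ∧
    ∀ x : ι, ∃ (t : ℕ) (s : State),
      Exec p (init (enc x)) t s ∧ spec x (output s) ∧
        t ≤ f (param x) * poly.eval (inputSize (enc x))

end RAM

/-! ### The matrix constraint `Regular²` and domain consistency -/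

namespace RegularSq

/-- Domains of the variables of an `R × C` matrix, with values among `0, …, d - 1`.
They are ordered by inclusion, variable by variable. -/
abbrev Domains (R C d : ℕ) : Type := Fin R → Fin C → Finset (Fin d)

/-- An instance of `Regular²`: an `R × C` matrix of variables with values among `0, …, d - 1`,
a DFA with `nQ` states for every row, a DFA with `nQ'` states for every column,
and a domain for every variable. -/
structure Instance where
  R : ℕ
  C : ℕ
  d : ℕ
  nQ : ℕ
  nQ' : ℕ
  row : Fin R → DFA (Fin d) (Fin nQ)
  col : Fin C → DFA (Fin d) (Fin nQ')
  dom : Domains R C d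

namespace Instance

/-- The assignment `M` satisfies the constraint: every row and every column is accepted by its
automaton. -/
def Satisfies (I : Instance) (M : Fin I.R → Fin I.C → Fin I.d) : Prop :=
  (∀ r, List.ofFn (fun c => M r c) ∈ (I.row r).accepts) ∧
    ∀ c, List.ofFn (fun r => M r c) ∈ (I.col c).accepts

/-- The constraint is domain consistent for the domains `D`: every value in the domain of a
variable has a support, that is, extends to a satisfying assignment within `D`. -/
def DomainConsistent (I : Instance) (D : Domains I.R I.C I.d) : Prop :=
  ∀ r c, ∀ v ∈ D r c, ∃ M : Fin I.R → Fin I.C → Fin I.d,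
    (∀ r' c', M r' c' ∈ D r' c') ∧ I.Satisfies M ∧ M r c = v

/-- `D` is the result of enforcing domain consistency on the instance: the largest domains within
the given ones for which the constraint is domain consistent. -/
def IsEnforcedDC (I : Instance) (D : Domains I.R I.C I.d) : Prop :=
  IsGreatest {D' : Domains I.R I.C I.d | D' ≤ I.dom ∧ I.DomainConsistent D'} D

/-- The parameter `C * |Q| * log₂ |Q'|`, rounded up. -/
noncomputable def param (I : Instance) : ℕ :=
  ⌈(I.C : ℝ) * (I.nQ : ℝ) * Real.logb 2 (I.nQ' : ℝ)⌉₊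

end Instance

open Classical in
/-- The truth value of a proposition as a bit. -/
noncomputable def bit (P : Prop) : ℕ := if P then 1 else 0

/-- A DFA as a list of numbers: initial state, acceptance bits of the states, transition table. -/
noncomputable def encodeDFA {d n : ℕ} (A : DFA (Fin d) (Fin n)) : List ℕ :=
  [(A.start : ℕ)] ++ (List.finRange n).map (fun q => bit (q ∈ A.accept)) ++
    (List.finRange n).flatMap fun q => (List.finRange d).map fun v => (A.step q v : ℕ)

/-- Domains as a list of bits: for every row, every column and every value, in this order,
whether the value belongs to the domain. -/
noncomputable def encodeDomains {R C d : ℕ} (D : Domains R C d) : List ℕ :=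
  (List.finRange R).flatMap fun r => (List.finRange C).flatMap fun c =>
    (List.finRange d).map fun v => bit (v ∈ D r c)

/-- An instance as a list of numbers: the five dimensions, the row automata, the column automata,
the domains. -/
noncomputable def encode (I : Instance) : List ℕ :=
  [I.R, I.C, I.d, I.nQ, I.nQ'] ++
    (List.finRange I.R).flatMap (fun r => encodeDFA (I.row r)) ++
    (List.finRange I.C).flatMap (fun c => encodeDFA (I.col c)) ++
    encodeDomains I.dom

/-- `y` encodes the domains that result from enforcing domain consistency on `I`. -/
def EnforcesDC (I : Instance) (y : List ℕ) : Prop :=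
  ∃ D : Domains I.R I.C I.d, I.IsEnforcedDC D ∧ y = encodeDomains D

end RegularSq

namespace RAM

/-! The matrix is filled cell by cell in row-major order. All that matters about the cells already
filled is the state of the current row automaton and, for each column, the state reached by its
automaton. The column states form a queue: its head belongs to the current cell, and processing the
cell removes the head and appends the new column state at the end. This leaves `nQ * nQ' ^ C` search
states. For each cell and each value, prescribing this value in this cell turns the existence of a
support into a reachability question (`Tables.reach_iff`, `Instance.supported_iff`), which is
answered by sweeping over the cells with one bit per search state.

The values that have a support within the given domains already form the largest domain consistent
subdomains (`isEnforcedDC_supportedDomains`), so no iteration to a fixed point is needed.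

If `R, C ≥ 1`, then the automata have start states, hence `nQ ≥ 1` and `nQ' ^ C = 2 ^ (C * log₂ nQ')
≤ 2 ^ k`, while the factor `nQ` is at most the input size `n`. Every loop of the program thus makes
at most `2 ^ k * n` rounds (`tables_le`). The loops are nested to a constant depth, so the running
time is polynomial in `2 ^ k * n` (`Cmd.exec_run`), which splits into a factor depending on `k` and
a polynomial in `n`. -/

theorem State.reg_setReg (s : State) (x v y : ℕ) :
    (s.setReg x v).reg y = if y = x then v else s.reg y := by
  simp [State.setReg, Function.update_apply]

theorem State.arr_setReg (s : State) (x v : ℕ) : (s.setReg x v).arr = s.arr := rfl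

theorem State.arr_setArr (s : State) (a i v b : ℕ) :
    (s.setArr a i v).arr b =
      if b = a then fun j => if j = i then v else s.arr a j else s.arr b := by
  by_cases h : b = a
  · subst h
    ext j
    simp [State.setArr, Function.update_apply]
  · simp [State.setArr, h]

/-! ### Commands with counted loops: semantics and running time -/

/-- Programs whose loops run over a counter with a bound held in a register. -/
inductive Cmd where
  | nop
  | assign (x : ℕ) (e : Expr)
  | store (a : ℕ) (i e : Expr)
  | seq (p q : Cmd)
  | ite (e : Expr) (p q : Cmd)
  | count (x y : ℕ) (p : Cmd)

namespace Cmd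

/-- The compilation into a machine program. -/
def toProg : Cmd → Prog
  | nop => .nop
  | assign x e => .assign x e
  | store a i e => .store a i e
  | seq p q => .seq p.toProg q.toProg
  | ite e p q => .ite e p.toProg q.toProg
  | count x y p => .seq (.assign x (.const 0))
      (.loop (.sub (.reg y) (.reg x)) (.seq p.toProg (.assign x (.add (.reg x) (.const 1)))))

/-- The state after `n` rounds of a loop with counter `x` and body `f`. -/
def rounds (f : State → State) (x : ℕ) (s : State) : ℕ → State
  | 0 => s.setReg x 0
  | i + 1 => (f (rounds f x s i)).setReg x (i + 1)

/-- The final state. -/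
def run : Cmd → State → State
  | nop, s => s
  | assign x e, s => s.setReg x (e.eval s)
  | store a i e, s => s.setArr a (i.eval s) (e.eval s)
  | seq p q, s => q.run (p.run s)
  | ite e p q, s => if e.eval s ≠ 0 then p.run s else q.run s
  | count x y p, s => rounds p.run x s (s.reg y)

/-- Whether the register `z` occurs as a target of an assignment or as a counter. -/
def writesReg (z : ℕ) : Cmd → Bool
  | nop => false
  | assign x _ => x == z
  | store _ _ _ => false
  | seq p q => p.writesReg z || q.writesReg z
  | ite _ p q => p.writesReg z || q.writesReg z
  | count x _ p => x == z || p.writesReg z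

/-- Whether the array `b` occurs as a target of a store. -/
def writesArr (b : ℕ) : Cmd → Bool
  | nop => false
  | assign _ _ => false
  | store a _ _ => a == b
  | seq p q => p.writesArr b || q.writesArr b
  | ite _ p q => p.writesArr b || q.writesArr b
  | count _ _ p => p.writesArr b

/-- Loop counters and loop bounds are not changed by the bodies of their loops. -/
def wellFormed : Cmd → Bool
  | nop => true
  | assign _ _ => true
  | store _ _ _ => true
  | seq p q => p.wellFormed && q.wellFormed
  | ite _ p q => p.wellFormed && q.wellFormed
  | count x y p => x != y && !p.writesReg x && !p.writesReg y && p.wellFormed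

/-- All loop bounds are registers that satisfy `ok` and are never written. -/
def boundsIn (ok : ℕ → Bool) : Cmd → Bool
  | nop => true
  | assign x _ => !ok x
  | store _ _ _ => true
  | seq p q => p.boundsIn ok && q.boundsIn ok
  | ite _ p q => p.boundsIn ok && q.boundsIn ok
  | count x y p => !ok x && ok y && p.boundsIn ok

/-- The number of nested loops. -/
def depth : Cmd → ℕ
  | nop => 0
  | assign _ _ => 0
  | store _ _ _ => 0
  | seq p q => max p.depth q.depth
  | ite _ p q => max p.depth q.depth
  | count _ _ p => p.depth + 1

/-- The number of steps of a run, up to the lengths of loops. -/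
def weight : Cmd → ℕ
  | nop => 1
  | assign _ e => e.cost + 1
  | store _ i e => i.cost + e.cost + 1
  | seq p q => p.weight + q.weight
  | ite e p q => e.cost + 1 + p.weight + q.weight
  | count _ _ p => p.weight + 14

variable {p : Cmd} {s : State}

theorem reg_rounds {f : State → State} {x z : ℕ} (h : ∀ s, (f s).reg z = s.reg z)
    (hz : x ≠ z) (n : ℕ) : (rounds f x s n).reg z = s.reg z := by
  induction n with
  | zero => simp [rounds, State.reg_setReg, hz.symm]
  | succ n ih => simp [rounds, State.reg_setReg, hz.symm, h, ih]

theorem arr_rounds {f : State → State} {x b : ℕ} (h : ∀ s, (f s).arr b = s.arr b)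
    (n : ℕ) : (rounds f x s n).arr b = s.arr b := by
  induction n with
  | zero => simp [rounds, State.arr_setReg]
  | succ n ih => simp [rounds, State.arr_setReg, h, ih]

theorem rounds_reg_counter (f : State → State) (x : ℕ) (s : State) (n : ℕ) :
    (rounds f x s n).reg x = n := by
  cases n <;> simp [rounds, State.reg_setReg]

/-- Frame rule with a syntactic, computable hypothesis: for concrete commands it is discharged by
`rfl`, without running the command. -/
theorem reg_run {z : ℕ} (h : p.writesReg z = false) (s : State) :
    (p.run s).reg z = s.reg z := by
  induction p generalizing s with
  | nop => rfl
  | assign x e =>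
    have : z ≠ x := by rintro rfl; simp [writesReg] at h
    simp [run, State.reg_setReg, this]
  | store => rfl
  | seq p q hp hq =>
    simp only [writesReg, Bool.or_eq_false_iff] at h
    rw [run, hq h.2, hp h.1]
  | ite e p q hp hq =>
    simp only [writesReg, Bool.or_eq_false_iff] at h
    rw [run]
    split
    · exact hp h.1 s
    · exact hq h.2 s
  | count x y p hp =>
    simp only [writesReg, Bool.or_eq_false_iff, beq_eq_false_iff_ne] at h
    exact reg_rounds (hp h.2) h.1 _

theorem arr_run {b : ℕ} (h : p.writesArr b = false) (s : State) :
    (p.run s).arr b = s.arr b := by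
  induction p generalizing s with
  | nop => rfl
  | assign x e => rfl
  | store a i e =>
    have : b ≠ a := by rintro rfl; simp [writesArr] at h
    simp [run, State.arr_setArr, this]
  | seq p q hp hq =>
    simp only [writesArr, Bool.or_eq_false_iff] at h
    rw [run, hq h.2, hp h.1]
  | ite e p q hp hq =>
    simp only [writesArr, Bool.or_eq_false_iff] at h
    rw [run]
    split
    · exact hp h.1 s
    · exact hq h.2 s
  | count x y p hp => exact arr_rounds (hp h) _

theorem writesReg_of_boundsIn {ok : ℕ → Bool} (h : p.boundsIn ok = true) {z : ℕ}
    (hz : ok z = true) : p.writesReg z = false := by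
  induction p with
  | nop => rfl
  | assign x e =>
    simp only [writesReg, beq_eq_false_iff_ne]
    rintro rfl
    simp [boundsIn, hz] at h
  | store => rfl
  | seq p q hp hq =>
    simp only [boundsIn, Bool.and_eq_true] at h
    simp [writesReg, hp h.1, hq h.2]
  | ite e p q hp hq =>
    simp only [boundsIn, Bool.and_eq_true] at h
    simp [writesReg, hp h.1, hq h.2]
  | count x y p hp =>
    simp only [boundsIn, Bool.and_eq_true] at h
    simp only [writesReg, hp h.2, Bool.or_false, beq_eq_false_iff_ne]
    rintro rfl
    simp [hz] at h

/-- A loop of `n` rounds is executed within `n` times the cost of a round. -/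
theorem exec_rounds {q : Prog} {f : State → State} {x y T : ℕ} {s : State} (hxy : x ≠ y)
    (hx : ∀ s, (f s).reg x = s.reg x) (hy : ∀ s, (f s).reg y = s.reg y)
    (hf : ∀ i < s.reg y, ∃ t ≤ T, Exec q (rounds f x s i) t (f (rounds f x s i)))
    (k n : ℕ) (hn : n + k = s.reg y) :
    ∃ t ≤ k * (T + 8) + 4,
      Exec (.loop (.sub (.reg y) (.reg x)) (.seq q (.assign x (.add (.reg x) (.const 1)))))
        (rounds f x s n) t (rounds f x s (s.reg y)) := by
  induction k generalizing n with
  | zero =>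
    obtain rfl : n = s.reg y := by omega
    refine ⟨4, by omega, ?_⟩
    refine Exec.loop_done ?_
    simp [Expr.eval, rounds_reg_counter, reg_rounds hy hxy]
  | succ k ih =>
    obtain ⟨t₁, ht₁, h₁⟩ := hf n (by omega)
    obtain ⟨t₂, ht₂, h₂⟩ := ih (n + 1) (by omega)
    have e : rounds f x s (n + 1) = (f (rounds f x s n)).setReg x
        (Expr.eval (f (rounds f x s n)) (.add (.reg x) (.const 1))) := by
      simp [rounds, Expr.eval, hx, rounds_reg_counter]
    have h₃ := Exec.assign (f (rounds f x s n)) x (.add (.reg x) (.const 1))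
    rw [← e] at h₃
    refine ⟨_, ?_, Exec.loop_step ?_ (Exec.seq h₁ h₃) h₂⟩
    -- A round costs 4 steps for the test and 4 for the increment besides the body; the final
    -- failing test accounts for the additional 4.
    · simp only [Expr.cost]
      rw [add_mul]
      omega
    · simp only [Expr.eval, rounds_reg_counter, reg_rounds hy hxy]
      omega

/-- A well-formed command all of whose loop bounds are at most `B` runs for a number of steps that
is polynomial in `B`. -/
theorem exec_run {ok : ℕ → Bool} {B : ℕ} (hw : p.wellFormed = true) (hb : p.boundsIn ok = true)
    (s : State) (hs : ∀ z, ok z = true → s.reg z ≤ B) :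
    ∃ t ≤ p.weight * (B + 1) ^ p.depth, Exec p.toProg s t (p.run s) := by
  induction p generalizing s with
  | nop => exact ⟨1, by simp [weight, depth], Exec.nop s⟩
  | assign x e => exact ⟨_, by simp [weight, depth], Exec.assign s x e⟩
  | store a i e => exact ⟨_, by simp [weight, depth], Exec.store s a i e⟩
  | seq p q hp hq =>
    simp only [wellFormed, boundsIn, Bool.and_eq_true] at hw hb
    obtain ⟨t₁, ht₁, h₁⟩ := hp hw.1 hb.1 s hs
    obtain ⟨t₂, ht₂, h₂⟩ := hq hw.2 hb.2 (p.run s) fun z hz => by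
      rw [reg_run (writesReg_of_boundsIn hb.1 hz)]
      exact hs z hz
    refine ⟨_, ?_, Exec.seq h₁ h₂⟩
    rw [weight, depth, add_mul]
    refine add_le_add (ht₁.trans ?_) (ht₂.trans ?_) <;>
      exact Nat.mul_le_mul_left _ (Nat.pow_le_pow_right (by omega) (by simp))
  | ite e p q hp hq =>
    simp only [wellFormed, boundsIn, Bool.and_eq_true] at hw hb
    have hpos : 1 ≤ (B + 1) ^ max p.depth q.depth := Nat.one_le_pow _ _ (by omega)
    by_cases h : e.eval s = 0
    · obtain ⟨t, ht, h'⟩ := hq hw.2 hb.2 s hs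
      refine ⟨_, ?_, by simpa [run, toProg, h] using Exec.ite_false h h'⟩
      have := ht.trans (Nat.mul_le_mul_left q.weight
        (Nat.pow_le_pow_right (by omega) (le_max_right p.depth q.depth) : (B + 1) ^ _ ≤ _))
      rw [weight, depth]
      nlinarith
    · obtain ⟨t, ht, h'⟩ := hp hw.1 hb.1 s hs
      refine ⟨_, ?_, by simpa [run, toProg, h] using Exec.ite_true h h'⟩
      have := ht.trans (Nat.mul_le_mul_left p.weight
        (Nat.pow_le_pow_right (by omega) (le_max_left p.depth q.depth) : (B + 1) ^ _ ≤ _))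
      rw [weight, depth]
      nlinarith
  | count x y p hp =>
    simp only [wellFormed, boundsIn, Bool.and_eq_true, bne_iff_ne, Bool.not_eq_true'] at hw hb
    obtain ⟨⟨⟨hxy, hx⟩, hy⟩, hw⟩ := hw
    obtain ⟨⟨hokx, hoky⟩, hb⟩ := hb
    have key := exec_rounds (q := p.toProg) (f := p.run) (x := x) (y := y)
      (T := p.weight * (B + 1) ^ p.depth) (s := s) hxy (reg_run hx) (reg_run hy)
      (fun i _ => hp hw hb _ fun z hz => by
        rw [reg_rounds (fun s => reg_run (writesReg_of_boundsIn hb hz) s)]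
        · exact hs z hz
        · rintro rfl
          simp [hz] at hokx) (s.reg y) 0 (by omega)
    obtain ⟨t, ht, h⟩ := key
    refine ⟨_, ?_, Exec.seq (Exec.assign s x (.const 0)) h⟩
    have h1 := hs y hoky
    have hpos : 1 ≤ (B + 1) ^ p.depth := Nat.one_le_pow _ _ (by omega)
    have h2 := Nat.mul_le_mul_right (p.weight * (B + 1) ^ p.depth + 8) h1
    have h3 : B + 1 ≤ (B + 1) * (B + 1) ^ p.depth := Nat.le_mul_of_pos_right _ hpos
    have h4 : B * (p.weight * (B + 1) ^ p.depth) ≤ (B + 1) * (p.weight * (B + 1) ^ p.depth) :=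
      Nat.mul_le_mul_right _ (by omega)
    -- The 14 in `weight` covers the overhead of 8 per round, and once 2 for resetting the counter
    -- and 4 for the last test.
    rw [weight, depth, pow_succ]
    simp only [Expr.cost]
    nlinarith

/-! ### Proof rules for counted loops -/

/-- The loop rule: a family of assertions that is established by resetting the counter and carried
from round to round holds with the loop bound in the end. -/
theorem run_count {x y : ℕ} (Inv : ℕ → State → Prop)
    (s : State) (h0 : Inv 0 (s.setReg x 0))
    (hstep : ∀ i < s.reg y, ∀ s' : State, s'.reg x = i →
      (∀ z, (count x y p).writesReg z = false → s'.reg z = s.reg z) →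
      (∀ b, p.writesArr b = false → s'.arr b = s.arr b) →
      Inv i s' → Inv (i + 1) ((p.run s').setReg x (i + 1))) :
    Inv (s.reg y) ((count x y p).run s) := by
  suffices ∀ n ≤ s.reg y, Inv n (rounds p.run x s n) from this _ le_rfl
  intro n hn
  induction n with
  | zero => exact h0
  | succ n ih =>
    refine hstep n (by omega) _ (rounds_reg_counter _ _ _ _) (fun z hz => ?_) (fun b hb => ?_)
      (ih (by omega))
    · simp only [writesReg, Bool.or_eq_false_iff, beq_eq_false_iff_ne] at hz
      exact reg_rounds (reg_run hz.2) hz.1 n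
    · exact arr_rounds (arr_run hb) n

/-- The command writes ones into the cells of the array `a` that satisfy `A`, and leaves the other
cells of this array unchanged. -/
def Marks (p : Cmd) (a : ℕ) (s : State) (A : ℕ → Prop) : Prop :=
  ∀ j, (A j → (p.run s).arr a j = 1) ∧ (¬ A j → (p.run s).arr a j = s.arr a j)

/-- Marks are never erased, so the rounds of a loop mark the union of what each of them marks. The
body has to mark `A i` from every state that agrees with `s` outside the registers and arrays that
the loop writes; hence `A i` cannot depend on earlier rounds. -/
theorem Marks.count {x y a n : ℕ} {A : ℕ → ℕ → Prop} (hn : s.reg y = n)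
    (h : ∀ i < n, ∀ s' : State, s'.reg x = i →
      (∀ z, (Cmd.count x y p).writesReg z = false → s'.reg z = s.reg z) →
      (∀ b, p.writesArr b = false → s'.arr b = s.arr b) → p.Marks a s' (A i)) :
    (Cmd.count x y p).Marks a s fun j => ∃ i < n, A i j := by
  subst hn
  intro j
  refine run_count (fun n s' => ((∃ i < n, A i j) → s'.arr a j = 1) ∧
    (¬ (∃ i < n, A i j) → s'.arr a j = s.arr a j)) s
    (by simp [State.arr_setReg]) fun i hi s' hx hz hb hinv => ?_
  have := h i hi s' hx hz hb j
  rw [State.arr_setReg]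
  by_cases h1 : A i j
  · exact ⟨fun _ => this.1 h1, fun hn => absurd ⟨i, Nat.lt_succ_self i, h1⟩ hn⟩
  · have e : (∃ k < i + 1, A k j) ↔ ∃ k < i, A k j := by
      refine ⟨fun ⟨k, hk, hA⟩ => ⟨k, ?_, hA⟩, fun ⟨k, hk, hA⟩ => ⟨k, by omega, hA⟩⟩
      rcases Nat.lt_succ_iff_lt_or_eq.1 hk with hk | rfl
      · exact hk
      · exact absurd hA h1
    rw [e, this.2 h1]
    exact hinv

/-- Overwriting an initial segment of an array. -/
theorem arr_run_count_store {x y a : ℕ} {e : Expr} {g : ℕ → ℕ} (s : State)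
    (hg : ∀ i < s.reg y, ∀ s' : State, s'.reg x = i →
      (∀ z ≠ x, s'.reg z = s.reg z) → (∀ b ≠ a, s'.arr b = s.arr b) → e.eval s' = g i) :
    ((count x y (store a (.reg x) e)).run s).arr a =
      fun j => if j < s.reg y then g j else s.arr a j := by
  refine run_count (fun n s' => s'.arr a = fun j => if j < n then g j else s.arr a j) s
    (by simp [State.arr_setReg])
    fun i hi s' hx hz hb hinv => ?_
  ext j
  rw [State.arr_setReg, run, State.arr_setArr, if_pos rfl]
  simp only [Expr.eval, hx, hinv]
  rcases lt_trichotomy j i with h | rfl | h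
  · simp [h.ne, h, Nat.lt_succ_of_lt h]
  · simp only [if_true, Nat.lt_succ_self]
    exact hg j hi s' hx (fun z hz' => hz z (by simp [writesReg, hz'.symm]))
      fun b hb' => hb b (by simp [writesArr, hb'.symm])
  · simp [h.ne', not_lt_of_gt h, show ¬ j < i + 1 by omega]

/-- `z := y * x`, with counter `k`. -/
def mul (k z y x : ℕ) : Cmd :=
  seq (assign z (.const 0)) (count k y (assign z (.add (.reg z) (.reg x))))

/-- An equation between whole states, so that `simp` can evaluate straight-line blocks containing
multiplications. -/
theorem run_mul {k z y x : ℕ} (hzk : z ≠ k) (hxk : x ≠ k) (hyz : y ≠ z) (hxz : x ≠ z)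
    (s : State) :
    (mul k z y x).run s = (s.setReg z (s.reg y * s.reg x)).setReg k (s.reg y) := by
  rw [mul, run, run, run]
  set f := (assign z (.add (.reg z) (.reg x))).run with hf
  have key : ∀ n, rounds f k (s.setReg z 0) n = (s.setReg z (n * s.reg x)).setReg k n := by
    intro n
    induction n with
    | zero => simp [rounds]
    | succ n ih =>
      rw [rounds, ih, hf, run]
      simp only [State.setReg, State.mk.injEq, Expr.eval, and_true]
      ext w
      simp only [Function.update_apply]
      split_ifs <;> simp_all [add_mul]
  simp only [Expr.eval]
  rw [key, State.reg_setReg, if_neg hyz]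

end Cmd

end RAM

namespace RegularSq

open RAM RAM.Cmd

/-! ### The search space and its transitions, in terms of the input array -/

/-- The dimensions of an instance and its encoding as a function. -/
structure Tables where
  R : ℕ
  C : ℕ
  d : ℕ
  nQ : ℕ
  nQ' : ℕ
  inp : ℕ → ℕ

namespace Tables

variable (τ : Tables)

/-- The length of the code of a row automaton. -/
def rowLen : ℕ := τ.d * τ.nQ + τ.nQ + 1

/-- The length of the code of a column automaton. -/
def colLen : ℕ := τ.d * τ.nQ' + τ.nQ' + 1

/-- The position of the code of the first column automaton. -/
def colOff : ℕ := τ.R * τ.rowLen + 5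

/-- The position of the domains. -/
def domOff : ℕ := τ.C * τ.colLen + τ.colOff

/-- The number of queues of `C - 1` column states. -/
def queues : ℕ := τ.nQ' ^ (τ.C - 1)

/-- The number of states of the search. -/
def size : ℕ := τ.nQ * (τ.nQ' * τ.queues)

def rowBase (r : ℕ) : ℕ := τ.rowLen * r + 5

def colBase (c : ℕ) : ℕ := τ.colLen * c + τ.colOff

def rowStart (r : ℕ) : ℕ := τ.inp (τ.rowBase r)

def rowAccept (r q : ℕ) : ℕ := τ.inp (τ.rowBase r + 1 + q)

def rowStep (r q v : ℕ) : ℕ := τ.inp (τ.rowBase r + 1 + τ.nQ + τ.d * q + v)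

def colStart (c : ℕ) : ℕ := τ.inp (τ.colBase c)

def colAccept (c q : ℕ) : ℕ := τ.inp (τ.colBase c + 1 + q)

def colStep (c q v : ℕ) : ℕ := τ.inp (τ.colBase c + 1 + τ.nQ' + τ.d * q + v)

def domBit (t v : ℕ) : ℕ := τ.inp (τ.domOff + τ.d * t + v)

/-- The state of row `r` after reading `v` in column `c`. -/
def rowNext (r c q v : ℕ) : ℕ := τ.rowStep r (if c = 0 then τ.rowStart r else q) v

/-- The state of column `c` after reading `v` in row `r`. -/
def colNext (r c a v : ℕ) : ℕ := τ.colStep c (if r = 0 then τ.colStart c else a) v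

/-- The value `v` is allowed in row `r` and column `c` where the next states are `q` and `a`, when
cell number `t₀` is prescribed to have the value `v₀`. -/
def Allowed (t₀ v₀ r c v q a : ℕ) : Prop :=
  τ.domBit (τ.C * r + c) v ≠ 0 ∧ (τ.C * r + c = t₀ → v = v₀) ∧
    (c = τ.C - 1 → τ.rowAccept r q ≠ 0) ∧ (r = τ.R - 1 → τ.colAccept c a ≠ 0)

/-- The effect of one cell on a set `X` of search states: a state consists of the state `q` of the
current row, and of a queue of column states with head `a` and tail `h`. -/
def Next (t₀ v₀ r c : ℕ) (X : ℕ → Prop) (y : ℕ) : Prop :=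
  ∃ h < τ.queues, ∃ a < τ.nQ', ∃ q < τ.nQ, ∃ v < τ.d,
    X (τ.nQ * (τ.nQ' * h + a) + q) ∧
    τ.Allowed t₀ v₀ r c v (τ.rowNext r c q v) (τ.colNext r c a v) ∧
    y = τ.nQ * (τ.queues * τ.colNext r c a v + h) + τ.rowNext r c q v

/-- The search states that are reachable by processing the first `t` cells. -/
def Reach (t₀ v₀ : ℕ) : ℕ → ℕ → Prop
  | 0, y => y = 0
  | t + 1, y => τ.Next t₀ v₀ (t / τ.C) (t % τ.C) (Reach t₀ v₀ t) y

/-- The value `v₀` is possible in cell number `t₀`. -/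
def Supported (t₀ v₀ : ℕ) : Prop := ∃ y < τ.size, τ.Reach t₀ v₀ (τ.C * τ.R) y

/-- The registers of a machine state hold the dimensions, and array `0` is the input. -/
structure Holds (s : State) : Prop where
  reg1 : s.reg 1 = τ.R
  reg2 : s.reg 2 = τ.C
  reg3 : s.reg 3 = τ.d
  reg4 : s.reg 4 = τ.nQ
  reg5 : s.reg 5 = τ.nQ'
  reg6 : s.reg 6 = τ.rowLen
  reg7 : s.reg 7 = τ.colLen
  reg8 : s.reg 8 = τ.colOff
  reg9 : s.reg 9 = τ.domOff
  reg10 : s.reg 10 = τ.C - 1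
  reg11 : s.reg 11 = τ.queues
  reg12 : s.reg 12 = τ.size
  reg13 : s.reg 13 = τ.R - 1
  arr0 : s.arr 0 = τ.inp

variable {τ} {s s' : State}

theorem Holds.congr (h : τ.Holds s) (hr : ∀ z < 14, 1 ≤ z → s'.reg z = s.reg z)
    (ha : s'.arr 0 = s.arr 0) : τ.Holds s' := by
  constructor <;> first
    | rw [hr _ (by norm_num) (by norm_num)]
    | rw [ha]
  exacts [h.reg1, h.reg2, h.reg3, h.reg4, h.reg5, h.reg6, h.reg7, h.reg8, h.reg9, h.reg10, h.reg11,
    h.reg12, h.reg13, h.arr0]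

theorem Holds.run (h : τ.Holds s) {p : Cmd}
    (hp : ((List.range 14).all fun z => z == 0 || !p.writesReg z) = true)
    (ha : p.writesArr 0 = false) : τ.Holds (p.run s) := by
  refine h.congr (fun z hz hz' => reg_run ?_ s) (arr_run ha s)
  have := List.all_eq_true.1 hp z (List.mem_range.2 hz)
  simp only [Bool.or_eq_true, beq_iff_eq, Bool.not_eq_true'] at this
  exact this.resolve_left (by omega)

end Tables

/-! ### The search program and its correctness -/

/-- A list of commands, one after the other. -/
def block : List Cmd → Cmd
  | [] => .nop
  | p :: l => .seq p (block l)

/-- A conditional without alternative. -/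
def onlyIf (e : Expr) (p : Cmd) : Cmd := .ite e p .nop

/-- Computes the addresses for the transition from a search state under a value. -/
def prepareStep : Cmd := block [
  mul 40 34 5 25,
  .assign 34 (.add (.reg 34) (.reg 26)),
  mul 40 35 4 34,
  .assign 35 (.add (.reg 35) (.reg 27)),
  .assign 36 (.reg 27),
  .ite (.reg 24) .nop (.assign 36 (.load 0 (.reg 32))),
  .assign 37 (.reg 26),
  .ite (.reg 23) .nop (.assign 37 (.load 0 (.reg 33))),
  mul 40 38 3 36,
  .assign 38 (.load 0
    (.add (.add (.add (.add (.reg 32) (.const 1)) (.reg 4)) (.reg 38)) (.reg 28))),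
  mul 40 39 3 37,
  .assign 39 (.load 0
    (.add (.add (.add (.add (.reg 33) (.const 1)) (.reg 5)) (.reg 39)) (.reg 28))),
  mul 40 41 11 39,
  .assign 41 (.add (.reg 41) (.reg 25)),
  mul 40 42 4 41,
  .assign 42 (.add (.reg 42) (.reg 38)),
  mul 40 43 3 31]

/-- Tests whether two registers are different. -/
def distinct (x y : ℕ) : Expr :=
  .add (.sub (.reg x) (.reg y)) (.sub (.reg y) (.reg x))

/-- Marks the successor in array `3` if the transition is possible. -/
def markStep : Cmd :=
  onlyIf (.load 2 (.reg 35)) <|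
  onlyIf (.load 0 (.add (.add (.reg 9) (.reg 43)) (.reg 28))) <|
  onlyIf (.add (distinct 31 30) (.sub (.const 1) (distinct 28 22))) <|
  onlyIf (.add (.sub (.reg 10) (.reg 24)) (.load 0 (.add (.add (.reg 32) (.const 1)) (.reg 38)))) <|
  onlyIf (.add (.sub (.reg 13) (.reg 23)) (.load 0 (.add (.add (.reg 33) (.const 1)) (.reg 39)))) <|
  .store 3 (.reg 42) (.const 1)

def step : Cmd := .seq prepareStep markStep

/-- Processes all transitions out of all states of array `2`. -/
def allSteps : Cmd :=
  .count 25 11 <| .count 26 5 <| .count 27 4 <| .count 28 3 step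

/-- Processes the cell in row `reg 23` and column `reg 24`. -/
def cell : Cmd := block [
  mul 40 31 2 23,
  .assign 31 (.add (.reg 31) (.reg 24)),
  mul 40 32 6 23,
  .assign 32 (.add (.reg 32) (.const 5)),
  mul 40 33 7 24,
  .assign 33 (.add (.reg 33) (.reg 8)),
  .count 29 12 (.store 3 (.reg 29) (.const 0)),
  allSteps,
  .count 29 12 (.store 2 (.reg 29) (.load 3 (.reg 29)))]

/-- The search for a solution with value `reg 22` in row `reg 20` and column `reg 21`, which marks
the output bit. -/
def search : Cmd := block [
  mul 40 30 2 20,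
  .assign 30 (.add (.reg 30) (.reg 21)),
  .count 29 12 (.store 2 (.reg 29) (.const 0)),
  .store 2 (.const 0) (.const 1),
  .count 23 1 (.count 24 2 cell),
  mul 40 44 3 30,
  .assign 44 (.add (.reg 44) (.reg 22)),
  .count 29 12 (onlyIf (.load 2 (.reg 29)) (.store 1 (.reg 44) (.const 1)))]

def searches : Cmd := .count 20 1 <| .count 21 2 <| .count 22 3 search

variable {τ : Tables} {s : State}

theorem distinct_eval_eq_zero {x y : ℕ} : (distinct x y).eval s = 0 ↔ s.reg x = s.reg y := by
  simp only [distinct, Expr.eval]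
  omega

theorem run_prepareStep (hs : τ.Holds s) {r c h a q v : ℕ}
    (h23 : s.reg 23 = r) (h24 : s.reg 24 = c) (h25 : s.reg 25 = h) (h26 : s.reg 26 = a)
    (h27 : s.reg 27 = q) (h28 : s.reg 28 = v) (h31 : s.reg 31 = τ.C * r + c)
    (h32 : s.reg 32 = τ.rowBase r) (h33 : s.reg 33 = τ.colBase c) :
    (prepareStep.run s).reg 35 = τ.nQ * (τ.nQ' * h + a) + q ∧
    (prepareStep.run s).reg 38 = τ.rowNext r c q v ∧
    (prepareStep.run s).reg 39 = τ.colNext r c a v ∧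
    (prepareStep.run s).reg 42 =
      τ.nQ * (τ.queues * τ.colNext r c a v + h) + τ.rowNext r c q v ∧
    (prepareStep.run s).reg 43 = τ.d * (τ.C * r + c) := by
  -- The first row and the first column are special: there the recorded state is replaced by the
  -- start state of the automaton.
  by_cases hr : r = 0 <;> by_cases hc : c = 0 <;>
    simp [prepareStep, block, run, run_mul, Expr.eval, State.reg_setReg, State.arr_setReg,
      Tables.rowNext, Tables.colNext, Tables.rowStep, Tables.colStep, Tables.rowStart,
      Tables.colStart, hr, hc, h23, h24, h25, h26, h27, h28, h31, h32, h33, hs.reg3, hs.reg4,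
      hs.reg5, hs.reg11, hs.arr0]

theorem marks_step (hs : τ.Holds s) {r c h a q v t₀ v₀ : ℕ} (hr : r < τ.R) (hc : c < τ.C)
    (h22 : s.reg 22 = v₀) (h23 : s.reg 23 = r) (h24 : s.reg 24 = c) (h25 : s.reg 25 = h)
    (h26 : s.reg 26 = a) (h27 : s.reg 27 = q) (h28 : s.reg 28 = v) (h30 : s.reg 30 = t₀)
    (h31 : s.reg 31 = τ.C * r + c) (h32 : s.reg 32 = τ.rowBase r)
    (h33 : s.reg 33 = τ.colBase c) :
    step.Marks 3 s fun y => s.arr 2 (τ.nQ * (τ.nQ' * h + a) + q) ≠ 0 ∧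
      τ.Allowed t₀ v₀ r c v (τ.rowNext r c q v) (τ.colNext r c a v) ∧
      y = τ.nQ * (τ.queues * τ.colNext r c a v + h) + τ.rowNext r c q v := by
  obtain ⟨g35, g38, g39, g42, g43⟩ := run_prepareStep hs h23 h24 h25 h26 h27 h28 h31 h32 h33
  have a2 : (prepareStep.run s).arr 2 = s.arr 2 := arr_run rfl s
  have a3 : (prepareStep.run s).arr 3 = s.arr 3 := arr_run rfl s
  have hs' : τ.Holds (prepareStep.run s) := hs.run rfl rfl
  have f22 : (prepareStep.run s).reg 22 = v₀ := (reg_run rfl s).trans h22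
  have f23 : (prepareStep.run s).reg 23 = r := (reg_run rfl s).trans h23
  have f24 : (prepareStep.run s).reg 24 = c := (reg_run rfl s).trans h24
  have f28 : (prepareStep.run s).reg 28 = v := (reg_run rfl s).trans h28
  have f30 : (prepareStep.run s).reg 30 = t₀ := (reg_run rfl s).trans h30
  have f31 : (prepareStep.run s).reg 31 = τ.C * r + c := (reg_run rfl s).trans h31
  have f32 : (prepareStep.run s).reg 32 = τ.rowBase r := (reg_run rfl s).trans h32
  have f33 : (prepareStep.run s).reg 33 = τ.colBase c := (reg_run rfl s).trans h33
  simp only [Marks, step, run]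
  generalize prepareStep.run s = u at *
  have e1 : (Expr.load 2 (.reg 35)).eval u = s.arr 2 (τ.nQ * (τ.nQ' * h + a) + q) := by
    simp [Expr.eval, g35, a2]
  have e2 : (Expr.load 0 (.add (.add (.reg 9) (.reg 43)) (.reg 28))).eval u =
      τ.domBit (τ.C * r + c) v := by
    simp [Expr.eval, g43, f28, hs'.reg9, hs'.arr0, Tables.domBit]
  -- A sum serves as a disjunction: the implication is read as "another cell, or the right value".
  have e3 : (Expr.add (distinct 31 30) (.sub (.const 1) (distinct 28 22))).eval u ≠ 0 ↔
      (τ.C * r + c = t₀ → v = v₀) := by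
    have d1 := distinct_eval_eq_zero (s := u) (x := 31) (y := 30)
    have d2 := distinct_eval_eq_zero (s := u) (x := 28) (y := 22)
    rw [f31, f30] at d1
    rw [f28, f22] at d2
    rw [← d1, ← d2]
    simp only [Expr.eval]
    omega
  -- Since `c ≤ C - 1`, the truncated difference vanishes exactly in the last column; only there
  -- does the acceptance bit decide.
  have e4 : (Expr.add (.sub (.reg 10) (.reg 24))
      (.load 0 (.add (.add (.reg 32) (.const 1)) (.reg 38)))).eval u ≠ 0 ↔
      (c = τ.C - 1 → τ.rowAccept r (τ.rowNext r c q v) ≠ 0) := by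
    simp only [Expr.eval, hs'.reg10, hs'.arr0, f24, f32, g38, Tables.rowAccept]
    omega
  have e5 : (Expr.add (.sub (.reg 13) (.reg 23))
      (.load 0 (.add (.add (.reg 33) (.const 1)) (.reg 39)))).eval u ≠ 0 ↔
      (r = τ.R - 1 → τ.colAccept c (τ.colNext r c a v) ≠ 0) := by
    simp only [Expr.eval, hs'.reg13, hs'.arr0, f23, f33, g39, Tables.colAccept]
    omega
  intro y
  simp only [markStep, onlyIf, run, Tables.Allowed, e1, e2, e3, e4, e5]
  split_ifs <;> simp_all [State.arr_setArr, Expr.eval]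

theorem marks_allSteps (hs : τ.Holds s) {r c t₀ v₀ : ℕ} (hr : r < τ.R) (hc : c < τ.C)
    (h22 : s.reg 22 = v₀) (h23 : s.reg 23 = r) (h24 : s.reg 24 = c) (h30 : s.reg 30 = t₀)
    (h31 : s.reg 31 = τ.C * r + c) (h32 : s.reg 32 = τ.rowBase r)
    (h33 : s.reg 33 = τ.colBase c) :
    allSteps.Marks 3 s (τ.Next t₀ v₀ r c fun x => s.arr 2 x ≠ 0) := by
  refine Marks.count hs.reg11 fun h _ s₁ l₁ z₁ b₁ => ?_
  refine Marks.count ((z₁ 5 rfl).trans hs.reg5) fun a _ s₂ l₂ z₂ b₂ => ?_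
  refine Marks.count ((z₂ 4 rfl).trans ((z₁ 4 rfl).trans hs.reg4)) fun q _ s₃ l₃ z₃ b₃ => ?_
  refine Marks.count ((z₃ 3 rfl).trans ((z₂ 3 rfl).trans ((z₁ 3 rfl).trans hs.reg3)))
    fun v _ s₄ l₄ z₄ b₄ => ?_
  have z (i : ℕ) (hi : allSteps.writesReg i = false) : s₄.reg i = s.reg i := by
    simp only [allSteps, writesReg, Bool.or_eq_false_iff] at hi
    rw [z₄ i, z₃ i, z₂ i, z₁ i] <;> simp [writesReg, hi]
  have b (i : ℕ) (hi : allSteps.writesArr i = false) : s₄.arr i = s.arr i := by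
    rw [b₄ i hi, b₃ i hi, b₂ i hi, b₁ i hi]
  rw [← b 2 rfl]
  refine marks_step (hs.congr (fun i hi hi' => z i ?_) (b 0 rfl)) hr hc ((z 22 rfl).trans h22)
    ((z 23 rfl).trans h23) ((z 24 rfl).trans h24) ?_ ?_ ?_ l₄ ((z 30 rfl).trans h30)
    ((z 31 rfl).trans h31) ((z 32 rfl).trans h32) ((z 33 rfl).trans h33)
  · interval_cases i <;> rfl
  · rw [z₄ 25 rfl, z₃ 25 rfl, z₂ 25 rfl, l₁]
  · rw [z₄ 26 rfl, z₃ 26 rfl, l₂]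
  · rw [z₄ 27 rfl, l₃]

/-- Transitions start only from codes below `size`, by the bounds on the digits `h`, `a`, `q`. Hence
whatever array `2` contains beyond `size` does no harm. -/
theorem Tables.Next.congr {t₀ v₀ r c y : ℕ} {X Y : ℕ → Prop} (h : ∀ x < τ.size, X x ↔ Y x) :
    τ.Next t₀ v₀ r c X y ↔ τ.Next t₀ v₀ r c Y y := by
  unfold Tables.Next
  refine exists_congr fun k => and_congr_right fun hk => exists_congr fun a =>
    and_congr_right fun ha => exists_congr fun q => and_congr_right fun hq => exists_congr fun v =>
    and_congr_right fun _ => and_congr_left fun _ => h _ ?_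
  have h1 : τ.nQ' * k + a < τ.nQ' * τ.queues := by
    have := Nat.mul_le_mul_left τ.nQ' (Nat.succ_le_of_lt hk)
    rw [Nat.succ_eq_add_one, mul_add] at this
    omega
  have := Nat.mul_le_mul_left τ.nQ (Nat.succ_le_of_lt h1)
  rw [Nat.succ_eq_add_one, mul_add] at this
  rw [Tables.size]
  omega

/-- Processing a cell replaces the set of search states in array `2` by the set of their
successors. -/
theorem run_cell (hs : τ.Holds s) {r c t₀ v₀ : ℕ} (hr : r < τ.R) (hc : c < τ.C)
    (h22 : s.reg 22 = v₀) (h23 : s.reg 23 = r) (h24 : s.reg 24 = c) (h30 : s.reg 30 = t₀)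
    {X : ℕ → Prop} (hX : ∀ y < τ.size, s.arr 2 y ≠ 0 ↔ X y) :
    ∀ y < τ.size, (cell.run s).arr 2 y ≠ 0 ↔ τ.Next t₀ v₀ r c X y := by
  set pre : Cmd := block [
    mul 40 31 2 23,
    .assign 31 (.add (.reg 31) (.reg 24)),
    mul 40 32 6 23,
    .assign 32 (.add (.reg 32) (.const 5)),
    mul 40 33 7 24,
    .assign 33 (.add (.reg 33) (.reg 8))] with hpre
  set clear : Cmd := .count 29 12 (.store 3 (.reg 29) (.const 0)) with hclear
  set copy : Cmd := .count 29 12 (.store 2 (.reg 29) (.load 3 (.reg 29))) with hcopy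
  have hrun : cell.run s = copy.run (allSteps.run (clear.run (pre.run s))) := rfl
  have p31 : (pre.run s).reg 31 = τ.C * r + c := by
    simp [pre, block, run, run_mul, Expr.eval, State.reg_setReg, h23, h24, hs.reg2]
  have p32 : (pre.run s).reg 32 = τ.rowBase r := by
    simp [pre, block, run, run_mul, Expr.eval, State.reg_setReg, h23, hs.reg6,
      Tables.rowBase]
  have p33 : (pre.run s).reg 33 = τ.colBase c := by
    simp [pre, block, run, run_mul, Expr.eval, State.reg_setReg, h24, hs.reg7, hs.reg8,
      Tables.colBase]
  have hs₁ : τ.Holds (pre.run s) := hs.run rfl rfl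
  have hs₂ : τ.Holds (clear.run (pre.run s)) := hs₁.run rfl rfl
  have hs₃ : τ.Holds (allSteps.run (clear.run (pre.run s))) := hs₂.run rfl rfl
  have fr (z : ℕ) (h₁ : pre.writesReg z = false) (h₂ : clear.writesReg z = false) :
      (clear.run (pre.run s)).reg z = s.reg z := by
    rw [reg_run h₂, reg_run h₁]
  have hclr : (clear.run (pre.run s)).arr 3 =
      fun j => if j < (pre.run s).reg 12 then 0 else (pre.run s).arr 3 j :=
    arr_run_count_store (g := fun _ => 0) _ fun _ _ _ _ _ _ => rfl
  have hcpy : (copy.run (allSteps.run (clear.run (pre.run s)))).arr 2 = fun j =>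
      if j < (allSteps.run (clear.run (pre.run s))).reg 12 then
        (allSteps.run (clear.run (pre.run s))).arr 3 j else
        (allSteps.run (clear.run (pre.run s))).arr 2 j :=
    arr_run_count_store (g := fun i => (allSteps.run (clear.run (pre.run s))).arr 3 i) _
      fun i _ s' hi _ hb => by rw [Expr.eval, Expr.eval, hi, hb 3 (by norm_num)]
  have hm := marks_allSteps hs₂ hr hc ((fr 22 rfl rfl).trans h22) ((fr 23 rfl rfl).trans h23)
    ((fr 24 rfl rfl).trans h24) ((fr 30 rfl rfl).trans h30)
    ((reg_run rfl _).trans p31) ((reg_run rfl _).trans p32) ((reg_run rfl _).trans p33)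
  intro y hy
  have hm := hm y
  rw [hrun, hcpy, hs₃.reg12]
  simp only [hy, if_true]
  have ha : (clear.run (pre.run s)).arr 2 = s.arr 2 :=
    (arr_run rfl _).trans (arr_run rfl _)
  rw [ha, Tables.Next.congr hX, hclr, hs₁.reg12] at hm
  simp only [hy, if_true] at hm
  by_cases h : τ.Next t₀ v₀ r c X y
  · simp [h, hm.1 h]
  · simp [h, hm.2 h]

theorem run_cells (hs : τ.Holds s) {t₀ v₀ : ℕ} (h22 : s.reg 22 = v₀) (h30 : s.reg 30 = t₀)
    (h0 : ∀ y < τ.size, s.arr 2 y ≠ 0 ↔ y = 0) :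
    ∀ y < τ.size, ((Cmd.count 23 1 (.count 24 2 cell)).run s).arr 2 y ≠ 0 ↔
      τ.Reach t₀ v₀ (τ.C * τ.R) y := by
  have := run_count (p := .count 24 2 cell) (x := 23) (y := 1)
    (fun n s' => ∀ y < τ.size, s'.arr 2 y ≠ 0 ↔ τ.Reach t₀ v₀ (τ.C * n) y) s
    (by simpa [State.arr_setReg, Tables.Reach] using h0) ?_
  · rwa [hs.reg1] at this
  intro r hr s₁ l₁ z₁ b₁ h₁
  rw [hs.reg1] at hr
  have e₁ : s₁.reg 2 = τ.C := (z₁ 2 rfl).trans hs.reg2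
  have := run_count (p := cell) (x := 24) (y := 2)
    (fun n s' => ∀ y < τ.size, s'.arr 2 y ≠ 0 ↔ τ.Reach t₀ v₀ (τ.C * r + n) y) s₁
    (by simpa [State.arr_setReg] using h₁) ?_
  · rwa [e₁] at this
  intro c hc s₂ l₂ z₂ b₂ h₂
  rw [e₁] at hc
  have hs₂ : τ.Holds s₂ := hs.congr (fun i hi hi' => by
    rw [z₂ i, z₁ i] <;> interval_cases i <;> rfl) ((b₂ 0 rfl).trans (b₁ 0 rfl))
  have := run_cell hs₂ hr hc (((z₂ 22 rfl).trans (z₁ 22 rfl)).trans h22)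
    ((z₂ 23 rfl).trans l₁) l₂ (((z₂ 30 rfl).trans (z₁ 30 rfl)).trans h30) h₂
  intro y hy
  -- Cell number `C * r + c` with `c < C` has quotient `r` and remainder `c`, as in the definition
  -- of `Reach`.
  rw [State.arr_setReg, this y hy, ← add_assoc, Tables.Reach, Nat.mul_add_mod, Nat.mod_eq_of_lt hc,
    Nat.mul_add_div (by omega), Nat.div_eq_of_lt hc, add_zero]

theorem marks_search (hs : τ.Holds s) {r₀ c₀ v₀ : ℕ}
    (h20 : s.reg 20 = r₀) (h21 : s.reg 21 = c₀) (h22 : s.reg 22 = v₀) :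
    search.Marks 1 s fun j => τ.Supported (τ.C * r₀ + c₀) v₀ ∧
      j = τ.d * (τ.C * r₀ + c₀) + v₀ := by
  set pre : Cmd := block [
    mul 40 30 2 20,
    .assign 30 (.add (.reg 30) (.reg 21))] with hpre
  set clear : Cmd := .count 29 12 (.store 2 (.reg 29) (.const 0)) with hclear
  set cells : Cmd := .count 23 1 (.count 24 2 cell) with hcells
  set post : Cmd := block [
    mul 40 44 3 30,
    .assign 44 (.add (.reg 44) (.reg 22))] with hpost
  set find : Cmd := .count 29 12 (onlyIf (.load 2 (.reg 29)) (.store 1 (.reg 44) (.const 1)))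
    with hfind
  set u := clear.run (pre.run s) with hu
  set w := cells.run (u.setArr 2 0 1) with hw
  have hrun : search.run s = find.run (post.run w) := rfl
  have p30 : (pre.run s).reg 30 = τ.C * r₀ + c₀ := by
    simp [pre, block, run, run_mul, Expr.eval, State.reg_setReg, h20, h21, hs.reg2]
  have hs₁ : τ.Holds (pre.run s) := hs.run rfl rfl
  have hs₂ : τ.Holds u := hs₁.run rfl rfl
  have hs₃ : τ.Holds (u.setArr 2 0 1) := hs₂.congr (fun _ _ _ => rfl)
    (by simp [State.arr_setArr])
  have hs₄ : τ.Holds w := hs₃.run rfl rfl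
  have hs₅ : τ.Holds (post.run w) := hs₄.run rfl rfl
  have u22 : u.reg 22 = v₀ := ((reg_run rfl _).trans (reg_run rfl s)).trans h22
  have u30 : u.reg 30 = τ.C * r₀ + c₀ := (reg_run rfl _).trans p30
  have w22 : w.reg 22 = v₀ := (reg_run rfl _).trans u22
  have w30 : w.reg 30 = τ.C * r₀ + c₀ := (reg_run rfl _).trans u30
  have q44 : (post.run w).reg 44 = τ.d * (τ.C * r₀ + c₀) + v₀ := by
    simp [post, block, run, run_mul, Expr.eval, State.reg_setReg, w22, w30, hs₄.reg3]
  have hclr : u.arr 2 = fun j => if j < (pre.run s).reg 12 then 0 else (pre.run s).arr 2 j :=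
    arr_run_count_store (g := fun _ => 0) _ fun _ _ _ _ _ _ => rfl
  have hreach := run_cells hs₃ u22 u30 fun y hy => by
    simp [State.arr_setArr, hclr, hs₁.reg12, hy]
  have hm : find.Marks 1 (post.run w) fun j => ∃ y < τ.size, w.arr 2 y ≠ 0 ∧
      j = τ.d * (τ.C * r₀ + c₀) + v₀ := by
    refine Marks.count hs₅.reg12 fun y hy s' hx hz hb j => ?_
    have e₁ : s'.reg 44 = τ.d * (τ.C * r₀ + c₀) + v₀ := (hz 44 rfl).trans q44
    have e₂ : s'.arr 2 = w.arr 2 := (hb 2 rfl).trans (arr_run rfl _)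
    simp only [onlyIf, run, Expr.eval, hx, e₁, e₂]
    split_ifs <;> simp_all [State.arr_setArr]
  intro j
  have hm := hm j
  have h1 : (post.run w).arr 1 = s.arr 1 := by
    rw [arr_run rfl, hw, arr_run rfl, State.arr_setArr, if_neg (by norm_num), hu, arr_run rfl,
      arr_run rfl]
  have h2 : (∃ y < τ.size, w.arr 2 y ≠ 0 ∧ j = τ.d * (τ.C * r₀ + c₀) + v₀) ↔
      τ.Supported (τ.C * r₀ + c₀) v₀ ∧ j = τ.d * (τ.C * r₀ + c₀) + v₀ := by
    rw [Tables.Supported]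
    constructor
    · rintro ⟨y, hy, h, e⟩
      exact ⟨⟨y, hy, (hreach y hy).1 h⟩, e⟩
    · rintro ⟨⟨y, hy, h⟩, e⟩
      exact ⟨y, hy, (hreach y hy).2 h, e⟩
  beta_reduce at hm
  rw [h2, h1] at hm
  rwa [hrun]

theorem marks_searches (hs : τ.Holds s) :
    searches.Marks 1 s fun j => ∃ r < τ.R, ∃ c < τ.C, ∃ v < τ.d,
      τ.Supported (τ.C * r + c) v ∧ j = τ.d * (τ.C * r + c) + v := by
  refine Marks.count hs.reg1 fun r _ s₁ l₁ z₁ b₁ => ?_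
  refine Marks.count ((z₁ 2 rfl).trans hs.reg2) fun c _ s₂ l₂ z₂ b₂ => ?_
  refine Marks.count ((z₂ 3 rfl).trans ((z₁ 3 rfl).trans hs.reg3)) fun v _ s₃ l₃ z₃ b₃ => ?_
  refine marks_search (hs.congr (fun i hi hi' => ?_)
    ((b₃ 0 rfl).trans ((b₂ 0 rfl).trans (b₁ 0 rfl)))) ?_ ?_ l₃
  · rw [z₃ i, z₂ i, z₁ i] <;> interval_cases i <;> rfl
  · rw [z₃ 20 rfl, z₂ 20 rfl, l₁]
  · rw [z₃ 21 rfl, l₂]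

/-! ### The complete algorithm, from the input array to the output bits -/

/-- Reads the dimensions. -/
def readDims : Cmd := block [
  .assign 1 (.load 0 (.const 0)),
  .assign 2 (.load 0 (.const 1)),
  .assign 3 (.load 0 (.const 2)),
  .assign 4 (.load 0 (.const 3)),
  .assign 5 (.load 0 (.const 4)),
  .assign 10 (.sub (.reg 2) (.const 1)),
  .assign 13 (.sub (.reg 1) (.const 1))]

/-- Computes the offsets within the input, the sizes of the search space and of the output. -/
def computeSizes : Cmd := block [
  mul 40 6 3 4,
  .assign 6 (.add (.add (.reg 6) (.reg 4)) (.const 1)),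
  mul 40 7 3 5,
  .assign 7 (.add (.add (.reg 7) (.reg 5)) (.const 1)),
  mul 40 8 1 6,
  .assign 8 (.add (.reg 8) (.const 5)),
  mul 40 9 2 7,
  .assign 9 (.add (.reg 9) (.reg 8)),
  .assign 11 (.const 1),
  .count 41 10 (.seq (mul 40 42 5 11) (.assign 11 (.reg 42))),
  mul 40 14 5 11,
  mul 40 12 4 14,
  mul 40 15 2 3,
  mul 40 0 1 15]

/-- The algorithm that enforces domain consistency. -/
def enforceDC : Prog :=
  .seq readDims.toProg <|
    .ite (.reg 1)
      (.ite (.reg 2) (.seq computeSizes.toProg searches.toProg) (.assign 0 (.const 0)))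
      (.assign 0 (.const 0))

/-- The detour through register 42 is needed because the target of `mul` must differ from its
factors. -/
theorem run_power (k : ℕ) (h10 : s.reg 10 = k) (h11 : s.reg 11 = 1) :
    ((Cmd.count 41 10 (.seq (mul 40 42 5 11) (.assign 11 (.reg 42)))).run s).reg 11 =
      s.reg 5 ^ k := by
  subst h10
  refine run_count (fun n s' => s'.reg 11 = s.reg 5 ^ n) s
    (by simp [State.reg_setReg, h11]) fun i _ s' _ hz _ h => ?_
  have e : s'.reg 5 = s.reg 5 := hz 5 rfl
  simp [run, run_mul, State.reg_setReg, Expr.eval, h, e, pow_succ']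

theorem run_computeSizes (h1 : s.reg 1 = τ.R) (h2 : s.reg 2 = τ.C) (h3 : s.reg 3 = τ.d)
    (h4 : s.reg 4 = τ.nQ) (h5 : s.reg 5 = τ.nQ') (h10 : s.reg 10 = τ.C - 1)
    (h13 : s.reg 13 = τ.R - 1) (ha : s.arr 0 = τ.inp) :
    τ.Holds (computeSizes.run s) ∧ (computeSizes.run s).reg 0 = τ.R * (τ.C * τ.d) := by
  set pre : Cmd := block [
    mul 40 6 3 4,
    .assign 6 (.add (.add (.reg 6) (.reg 4)) (.const 1)),
    mul 40 7 3 5,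
    .assign 7 (.add (.add (.reg 7) (.reg 5)) (.const 1)),
    mul 40 8 1 6,
    .assign 8 (.add (.reg 8) (.const 5)),
    mul 40 9 2 7,
    .assign 9 (.add (.reg 9) (.reg 8)),
    .assign 11 (.const 1)] with hpre
  set power : Cmd := .count 41 10 (.seq (mul 40 42 5 11) (.assign 11 (.reg 42))) with hpower
  set post : Cmd := block [
    mul 40 14 5 11,
    mul 40 12 4 14,
    mul 40 15 2 3,
    mul 40 0 1 15] with hpost
  have hrun : computeSizes.run s = post.run (power.run (pre.run s)) := rfl
  have z (i : ℕ) (h₁ : pre.writesReg i = false) (h₂ : power.writesReg i = false) :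
      (power.run (pre.run s)).reg i = s.reg i := by
    rw [reg_run h₂, reg_run h₁]
  have p : (pre.run s).reg 6 = τ.rowLen ∧ (pre.run s).reg 7 = τ.colLen ∧
      (pre.run s).reg 8 = τ.colOff ∧ (pre.run s).reg 9 = τ.domOff ∧ (pre.run s).reg 11 = 1 := by
    simp [pre, block, run, run_mul, Expr.eval, State.reg_setReg, h1, h2, h3, h4, h5,
      Tables.domOff, Tables.colOff, Tables.rowLen, Tables.colLen]
  obtain ⟨p6, p7, p8, p9, p11⟩ := p
  have q11 : (power.run (pre.run s)).reg 11 = τ.queues := by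
    rw [run_power _ ((reg_run rfl _).trans h10) p11, reg_run rfl, h5, Tables.queues]
  have q1 := (z 1 rfl rfl).trans h1
  have q2 := (z 2 rfl rfl).trans h2
  have q3 := (z 3 rfl rfl).trans h3
  have q4 := (z 4 rfl rfl).trans h4
  have q5 := (z 5 rfl rfl).trans h5
  have q6 : (power.run (pre.run s)).reg 6 = _ := (reg_run rfl _).trans p6
  have q7 : (power.run (pre.run s)).reg 7 = _ := (reg_run rfl _).trans p7
  have q8 : (power.run (pre.run s)).reg 8 = _ := (reg_run rfl _).trans p8
  have q9 : (power.run (pre.run s)).reg 9 = _ := (reg_run rfl _).trans p9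
  have r : (computeSizes.run s).reg 12 = τ.size ∧
      (computeSizes.run s).reg 0 = τ.R * (τ.C * τ.d) := by
    rw [hrun]
    generalize power.run (pre.run s) = u at *
    simp [post, block, run, run_mul, State.reg_setReg, q1, q2, q3, q4, q5, q11, Tables.size]
  rw [hrun] at r ⊢
  refine ⟨?_, r.2⟩
  exact {
    reg1 := (reg_run rfl _).trans q1
    reg2 := (reg_run rfl _).trans q2
    reg3 := (reg_run rfl _).trans q3
    reg4 := (reg_run rfl _).trans q4
    reg5 := (reg_run rfl _).trans q5
    reg6 := (reg_run rfl _).trans q6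
    reg7 := (reg_run rfl _).trans q7
    reg8 := (reg_run rfl _).trans q8
    reg9 := (reg_run rfl _).trans q9
    reg10 := (reg_run rfl _).trans ((z 10 rfl rfl).trans h10)
    reg11 := (reg_run rfl _).trans q11
    reg12 := r.1
    reg13 := (reg_run rfl _).trans ((z 13 rfl rfl).trans h13)
    arr0 := (arr_run rfl _).trans ((arr_run rfl _).trans ((arr_run rfl _).trans ha)) }

/-- The input starts with the dimensions. -/
structure Tables.Reads (τ : Tables) (l : List ℕ) : Prop where
  inp : ∀ i, l.getD i 0 = τ.inp i
  inp0 : τ.inp 0 = τ.R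
  inp1 : τ.inp 1 = τ.C
  inp2 : τ.inp 2 = τ.d
  inp3 : τ.inp 3 = τ.nQ
  inp4 : τ.inp 4 = τ.nQ'

variable {l : List ℕ}

theorem run_readDims (h : τ.Reads l) :
    (readDims.run (init l)).reg 1 = τ.R ∧ (readDims.run (init l)).reg 2 = τ.C ∧
    (readDims.run (init l)).reg 3 = τ.d ∧ (readDims.run (init l)).reg 4 = τ.nQ ∧
    (readDims.run (init l)).reg 5 = τ.nQ' ∧ (readDims.run (init l)).reg 10 = τ.C - 1 ∧
    (readDims.run (init l)).reg 13 = τ.R - 1 ∧ (readDims.run (init l)).arr 0 = τ.inp := by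
  have h0 : (init l).arr 0 = τ.inp := by
    ext i
    simp [init, ← h.inp]
  simp [readDims, block, run, Expr.eval, State.reg_setReg, State.arr_setReg, h0, h.inp0, h.inp1,
    h.inp2, h.inp3, h.inp4]

/-- The total weight of the algorithm. -/
def totalWeight : ℕ := readDims.weight + computeSizes.weight + searches.weight + 6

/-- An empty matrix is handled before any multiplication: without row automata, say, no table backs
the number `nQ`, which may be exponential in the bit length of the input and must not bound a loop.
-/
theorem exec_enforceDC_of_eq_zero (h : τ.Reads l) (h0 : τ.R = 0 ∨ τ.C = 0) :
    ∃ t ≤ totalWeight, ∃ s, Exec enforceDC (init l) t s ∧ output s = [] := by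
  obtain ⟨t, ht, he⟩ := exec_run (p := readDims) (ok := fun _ => false) (B := 0) rfl rfl (init l)
    (by simp)
  obtain ⟨h1, h2, -⟩ := run_readDims h
  rw [Nat.zero_add, one_pow, mul_one] at ht
  have ha := Exec.assign (readDims.run (init l)) 0 (.const 0)
  have ho : output ((readDims.run (init l)).setReg 0 ((Expr.const 0).eval
      (readDims.run (init l)))) = [] := by
    simp [output, State.reg_setReg, Expr.eval]
  by_cases hR : τ.R = 0
  · refine ⟨_, ?_, _, Exec.seq he (Exec.ite_false (by simpa [Expr.eval] using h1.trans hR) ha), ho⟩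
    simp only [Expr.cost, totalWeight]
    omega
  · refine ⟨_, ?_, _, Exec.seq he (Exec.ite_true (by simpa [Expr.eval, h1] using hR)
      (Exec.ite_false (by simpa [Expr.eval, h2] using h0.resolve_left hR) ha)), ho⟩
    simp only [Expr.cost, totalWeight]
    omega

theorem exec_enforceDC (h : τ.Reads l) (hR : τ.R ≠ 0) (hC : τ.C ≠ 0) {B : ℕ}
    (hB : ∀ x ∈ [τ.R, τ.C, τ.d, τ.nQ, τ.nQ', τ.rowLen, τ.colLen, τ.queues, τ.size], x ≤ B) :
    ∃ t ≤ totalWeight * (B + 1) ^ searches.depth, ∃ s, Exec enforceDC (init l) t s ∧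
      s.reg 0 = τ.R * (τ.C * τ.d) ∧
      ∀ j, ((∃ r < τ.R, ∃ c < τ.C, ∃ v < τ.d,
        τ.Supported (τ.C * r + c) v ∧ j = τ.d * (τ.C * r + c) + v) → s.arr 1 j = 1) ∧
        (¬ (∃ r < τ.R, ∃ c < τ.C, ∃ v < τ.d,
        τ.Supported (τ.C * r + c) v ∧ j = τ.d * (τ.C * r + c) + v) → s.arr 1 j = 0) := by
  simp only [List.mem_cons, List.not_mem_nil, or_false, forall_eq_or_imp, forall_eq] at hB
  obtain ⟨b1, b2, b3, b4, b5, b6, b7, b11, b12⟩ := hB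
  obtain ⟨h1, h2, h3, h4, h5, h10, h13, ha⟩ := run_readDims h
  obtain ⟨hs, hlen⟩ := run_computeSizes h1 h2 h3 h4 h5 h10 h13 ha
  obtain ⟨t₁, ht₁, e₁⟩ := exec_run (p := readDims) (ok := fun _ => false) (B := B) rfl rfl (init l)
    (by simp)
  -- The registers admitted by `ok` are those that bound loops. The loop in `mul` runs over its
  -- first factor, which is always one of them, while the second factor may be large.
  obtain ⟨t₂, ht₂, e₂⟩ := exec_run (p := computeSizes)
    (ok := fun z => (1 ≤ z && z ≤ 5) || z == 10) (B := B) rfl rfl (readDims.run (init l)) (by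
      intro z hz
      simp only [Bool.or_eq_true, Bool.and_eq_true, decide_eq_true_eq, beq_iff_eq] at hz
      have : z = 1 ∨ z = 2 ∨ z = 3 ∨ z = 4 ∨ z = 5 ∨ z = 10 := by omega
      rcases this with rfl | rfl | rfl | rfl | rfl | rfl <;> omega)
  obtain ⟨t₃, ht₃, e₃⟩ := exec_run (p := searches)
    (ok := fun z => (1 ≤ z && z ≤ 7) || z == 11 || z == 12) (B := B) rfl rfl
    (computeSizes.run (readDims.run (init l))) (by
      intro z hz
      simp only [Bool.or_eq_true, Bool.and_eq_true, decide_eq_true_eq, beq_iff_eq] at hz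
      have : z = 1 ∨ z = 2 ∨ z = 3 ∨ z = 4 ∨ z = 5 ∨ z = 6 ∨ z = 7 ∨ z = 11 ∨ z = 12 := by omega
      have k1 := hs.reg1
      have k2 := hs.reg2
      have k3 := hs.reg3
      have k4 := hs.reg4
      have k5 := hs.reg5
      have k6 := hs.reg6
      have k7 := hs.reg7
      have k11 := hs.reg11
      have k12 := hs.reg12
      rcases this with rfl | rfl | rfl | rfl | rfl | rfl | rfl | rfl | rfl <;> omega)
  refine ⟨_, ?_, _, Exec.seq e₁ (Exec.ite_true (by simpa [Expr.eval, h1] using hR)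
    (Exec.ite_true (by simpa [Expr.eval, h2] using hC) (Exec.seq e₂ e₃))), ?_, fun j => ?_⟩
  · have hp {a : ℕ} (h : a ≤ searches.depth) : (B + 1) ^ a ≤ (B + 1) ^ searches.depth :=
      Nat.pow_le_pow_right (by omega) h
    have m₁ := ht₁.trans
      (Nat.mul_le_mul_left readDims.weight (hp (a := readDims.depth) (by decide)))
    have m₂ := ht₂.trans
      (Nat.mul_le_mul_left computeSizes.weight (hp (a := computeSizes.depth) (by decide)))
    have m₀ := Nat.one_le_pow searches.depth (B + 1) (by omega)
    simp only [Expr.cost, totalWeight, add_mul]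
    omega
  · rw [reg_run rfl, hlen]
  · have hm := marks_searches hs j
    have h0 : (computeSizes.run (readDims.run (init l))).arr 1 j = 0 := by
      rw [arr_run rfl, arr_run rfl]
      simp [init]
    rwa [h0] at hm

/-! ### Reachable search states are the codes of partial assignments -/

namespace Tables

variable (τ : Tables)

/-- The state of the current row after the first `t` cells of an assignment `W`. -/
def rowState (W : ℕ → ℕ) : ℕ → ℕ
  | 0 => 0
  | t + 1 => τ.rowNext (t / τ.C) (t % τ.C) (rowState W t) (W t)

/-- The state of column `c` after the first `r` rows of an assignment `W`. -/
def colState (W : ℕ → ℕ) (c : ℕ) : ℕ → ℕ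
  | 0 => 0
  | r + 1 => τ.colNext r c (colState W c r) (W (τ.C * r + c))

/-- The state of the column of cell `t` before this cell. -/
def cellState (W : ℕ → ℕ) (t : ℕ) : ℕ := τ.colState W (t % τ.C) (t / τ.C)

/-- The code of the states before `n` consecutive cells. -/
def queue (W : ℕ → ℕ) (t n : ℕ) : ℕ := ∑ j ∈ Finset.range n, τ.nQ' ^ j * τ.cellState W (t + j)

/-- The search state before cell `t`. -/
def code (W : ℕ → ℕ) (t : ℕ) : ℕ := τ.nQ * τ.queue W t τ.C + τ.rowState W t

/-- The value of the assignment in cell `t` is allowed. -/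
def Good (t₀ v₀ : ℕ) (W : ℕ → ℕ) (t : ℕ) : Prop :=
  W t < τ.d ∧ τ.Allowed t₀ v₀ (t / τ.C) (t % τ.C) (W t) (τ.rowState W (t + 1))
    (τ.cellState W (t + τ.C))

/-- The transition tables contain states. -/
structure Bounded : Prop where
  pos_C : 0 < τ.C
  pos_nQ : 0 < τ.nQ
  pos_nQ' : 0 < τ.nQ'
  rowStart_lt : ∀ r < τ.R, τ.rowStart r < τ.nQ
  rowStep_lt : ∀ r < τ.R, ∀ q < τ.nQ, ∀ v < τ.d, τ.rowStep r q v < τ.nQ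
  colStart_lt : ∀ c < τ.C, τ.colStart c < τ.nQ'
  colStep_lt : ∀ c < τ.C, ∀ a < τ.nQ', ∀ v < τ.d, τ.colStep c a v < τ.nQ'

variable {τ} {W W' : ℕ → ℕ} {t t₀ v₀ : ℕ}

theorem cellState_add (hC : 0 < τ.C) (W : ℕ → ℕ) (t : ℕ) :
    τ.cellState W (t + τ.C) = τ.colNext (t / τ.C) (t % τ.C) (τ.cellState W t) (W t) := by
  rw [cellState, Nat.add_mod_right, Nat.add_div_right _ hC, colState, Nat.div_add_mod, cellState]

theorem cellState_of_lt {t : ℕ} (h : t < τ.C) : τ.cellState W t = 0 := by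
  rw [cellState, Nat.div_eq_of_lt h, colState]

theorem rowState_congr (h : ∀ s < t, W s = W' s) : τ.rowState W t = τ.rowState W' t := by
  induction t with
  | zero => rfl
  | succ t ih => rw [rowState, rowState, ih fun s hs => h s (by omega), h t (by omega)]

/-- The state before cell `u` depends only on the cells `u - C`, `u - 2 * C`, … above it, all of
which precede `t`. -/
theorem cellState_congr (hC : 0 < τ.C) (h : ∀ s < t, W s = W' s) {u : ℕ} (hu : u < t + τ.C) :
    τ.cellState W u = τ.cellState W' u := by
  induction u using Nat.strong_induction_on with
  | _ u ih =>
    rcases lt_or_ge u τ.C with h' | h'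
    · rw [cellState_of_lt h', cellState_of_lt h']
    · obtain ⟨u, rfl⟩ := Nat.exists_eq_add_of_le' h'
      rw [cellState_add hC, cellState_add hC, ih u (by omega) (by omega), h u (by omega)]

theorem queue_succ (W : ℕ → ℕ) (t n : ℕ) :
    τ.queue W t (n + 1) = τ.nQ' ^ n * τ.cellState W (t + n) + τ.queue W t n := by
  rw [queue, Finset.sum_range_succ, add_comm, queue]

/-- The head of the queue is its least significant digit, whereas `queue_succ` splits off the most
significant one. Together they describe removing the head and appending at the end. -/
theorem queue_succ' (W : ℕ → ℕ) (t n : ℕ) :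
    τ.queue W t (n + 1) = τ.nQ' * τ.queue W (t + 1) n + τ.cellState W t := by
  rw [queue, Finset.sum_range_succ', queue, Finset.mul_sum]
  simp only [pow_zero, one_mul, add_zero, pow_succ']
  congr 1
  refine Finset.sum_congr rfl fun j _ => ?_
  rw [mul_assoc, add_right_comm, add_assoc]

theorem queue_lt {n : ℕ} (h : ∀ j < n, τ.cellState W (t + j) < τ.nQ') :
    τ.queue W t n < τ.nQ' ^ n := by
  induction n with
  | zero => simp [queue]
  | succ n ih =>
    rw [queue_succ, pow_succ]
    have h1 := ih fun j hj => h j (by omega)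
    have h2 := Nat.mul_le_mul_left (τ.nQ' ^ n) (Nat.succ_le_of_lt (h n (by omega)))
    rw [Nat.succ_eq_add_one, mul_add] at h2
    omega

theorem queue_congr (hC : 0 < τ.C) (h : ∀ s < t, W s = W' s) {u n : ℕ} (hu : u + n ≤ t + τ.C) :
    τ.queue W u n = τ.queue W' u n :=
  Finset.sum_congr rfl fun j hj => by
    rw [cellState_congr hC h]
    have := Finset.mem_range.1 hj
    omega

theorem code_eq (hC : 0 < τ.C) (W : ℕ → ℕ) (t : ℕ) : τ.code W t =
    τ.nQ * (τ.nQ' * τ.queue W (t + 1) (τ.C - 1) + τ.cellState W t) + τ.rowState W t := by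
  rw [code, ← queue_succ', Nat.sub_add_cancel hC]

/-- The queue moves on by one cell: its tail of length `C - 1` is kept, and the new state of the
current column, which is next used at cell `t + C`, becomes the top digit of weight `nQ' ^ (C - 1)`.
-/
theorem code_succ (hC : 0 < τ.C) (W : ℕ → ℕ) (t : ℕ) : τ.code W (t + 1) =
    τ.nQ * (τ.queues * τ.colNext (t / τ.C) (t % τ.C) (τ.cellState W t) (W t) +
      τ.queue W (t + 1) (τ.C - 1)) + τ.rowNext (t / τ.C) (t % τ.C) (τ.rowState W t) (W t) := by
  obtain ⟨n, hn⟩ := Nat.exists_eq_add_of_le' hC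
  have := queue_succ (τ := τ) W (t + 1) n
  rw [Nat.succ_eq_add_one, zero_add] at hn
  rw [code, ← rowState, ← cellState_add hC, queues, hn, this, Nat.add_sub_cancel,
    add_right_comm t 1 n, add_assoc t n 1]

theorem rowState_lt (hb : τ.Bounded) (ht : t ≤ τ.C * τ.R) (hW : ∀ s < t, W s < τ.d) :
    τ.rowState W t < τ.nQ := by
  induction t with
  | zero => exact hb.pos_nQ
  | succ t ih =>
    have hr : t / τ.C < τ.R := Nat.div_lt_of_lt_mul (by omega)
    refine hb.rowStep_lt _ hr _ ?_ _ (hW t (by omega))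
    split
    · exact hb.rowStart_lt _ hr
    · exact ih (by omega) fun s hs => hW s (by omega)

theorem cellState_lt (hb : τ.Bounded) (hW : ∀ s < t, W s < τ.d)
    {u : ℕ} (hu : u < t + τ.C) : τ.cellState W u < τ.nQ' := by
  induction u using Nat.strong_induction_on with
  | _ u ih =>
    rcases lt_or_ge u τ.C with h' | h'
    · rw [cellState_of_lt h']
      exact hb.pos_nQ'
    · obtain ⟨u, rfl⟩ := Nat.exists_eq_add_of_le' h'
      have hC := hb.pos_C
      rw [cellState_add hC]
      have hc : u % τ.C < τ.C := Nat.mod_lt _ hC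
      refine hb.colStep_lt _ hc _ ?_ _ (hW u (by omega))
      split
      · exact hb.colStart_lt _ hc
      · exact ih u (by omega) (by omega)

theorem tail_lt (hb : τ.Bounded) (hW : ∀ s < t, W s < τ.d) :
    τ.queue W (t + 1) (τ.C - 1) < τ.queues :=
  queue_lt fun j hj => cellState_lt hb hW (by omega)

theorem code_lt (hb : τ.Bounded) (ht : t ≤ τ.C * τ.R) (hW : ∀ s < t, W s < τ.d) :
    τ.code W t < τ.size := by
  have h1 : τ.queue W t τ.C < τ.nQ' ^ τ.C :=
    queue_lt fun j hj => cellState_lt hb hW (by omega)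
  have h2 : τ.nQ' ^ τ.C = τ.nQ' * τ.queues := by
    rw [queues, ← pow_succ', Nat.sub_add_cancel hb.pos_C]
  have h3 := Nat.mul_le_mul_left τ.nQ (Nat.succ_le_of_lt h1)
  rw [Nat.succ_eq_add_one, mul_add, h2] at h3
  have h4 := rowState_lt hb ht hW
  rw [code, size]
  omega

theorem eq_of_mul_add_eq {n a b x y : ℕ} (hx : x < n) (hy : y < n)
    (h : n * a + x = n * b + y) : a = b ∧ x = y := by
  have h1 := congrArg (· % n) h
  simp only [Nat.mul_add_mod, Nat.mod_eq_of_lt hx, Nat.mod_eq_of_lt hy] at h1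
  exact ⟨Nat.eq_of_mul_eq_mul_left (by omega : 0 < n) (by omega), h1⟩

/-- Induction on the number of cells. A code determines its digits, so a transition out of the code
of `W` extends `W` by the value `v` in cell `t`; conversely, each good cell of an assignment is a
transition. -/
theorem reach_iff (hb : τ.Bounded) (ht : t ≤ τ.C * τ.R) {y : ℕ} :
    τ.Reach t₀ v₀ t y ↔ ∃ W, (∀ s < t, τ.Good t₀ v₀ W s) ∧ y = τ.code W t := by
  have hC := hb.pos_C
  induction t generalizing y with
  | zero =>
    have : ∀ W, τ.code W 0 = 0 := fun W => by
      have : τ.queue W 0 τ.C = 0 := Finset.sum_eq_zero fun j hj => by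
        rw [zero_add, cellState_of_lt (Finset.mem_range.1 hj), mul_zero]
      rw [code, this, rowState]
      rfl
    simp [Reach, this]
  | succ t ih =>
    rw [Reach]
    constructor
    · rintro ⟨h, hh, a, ha, q, hq, v, hv, hX, hA, rfl⟩
      obtain ⟨W, hW, he⟩ := (ih (by omega)).1 hX
      have hWd : ∀ s < t, W s < τ.d := fun s hs => (hW s hs).1
      rw [code_eq hC] at he
      obtain ⟨he', rfl⟩ := eq_of_mul_add_eq hq (rowState_lt hb (by omega) hWd) he
      obtain ⟨rfl, rfl⟩ := eq_of_mul_add_eq ha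
        (cellState_lt hb hWd (Nat.lt_add_of_pos_right hC)) he'
      -- Changing cell `t` affects neither the row states up to `t` nor the column states before
      -- cell `t + C`, so the earlier cells remain good.
      have hag : ∀ s < t, W s = Function.update W t v s := fun s hs => by
        rw [Function.update_of_ne hs.ne]
      have hr : ∀ s ≤ t, τ.rowState (Function.update W t v) s = τ.rowState W s := fun s hs =>
        (rowState_congr fun u hu => hag u (by omega)).symm
      have hc : ∀ s < t + τ.C, τ.cellState (Function.update W t v) s = τ.cellState W s :=
        fun s hs => (cellState_congr hC hag hs).symm
      refine ⟨Function.update W t v, fun s hs => ?_, ?_⟩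
      · rcases Nat.lt_succ_iff_lt_or_eq.1 hs with hs | rfl
        · rw [Good, hr _ (by omega), hc _ (by omega), ← hag s hs]
          exact hW s hs
        · rw [Good, cellState_add hC, hc _ (by omega), rowState, hr _ le_rfl,
            Function.update_self]
          exact ⟨hv, hA⟩
      · rw [code_succ hC, hc _ (by omega), hr _ le_rfl, Function.update_self,
          queue_congr hC hag (by omega)]
    · rintro ⟨W, hW, rfl⟩
      have hWd : ∀ s < t, W s < τ.d := fun s hs => (hW s (by omega)).1
      have hg := hW t (by omega)
      rw [Good, cellState_add hC, rowState] at hg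
      exact ⟨_, tail_lt hb hWd, _, cellState_lt hb hWd (by omega), _,
        rowState_lt hb (by omega) hWd, W t, hg.1,
        (ih (by omega)).2 ⟨W, fun s hs => hW s (by omega), (code_eq hC W t).symm⟩, hg.2,
        code_succ hC W t⟩

/-- Acceptance is tested cell by cell, so any final search state will do; `code_lt` places it in the
range that the program inspects. -/
theorem supported_iff (hb : τ.Bounded) :
    τ.Supported t₀ v₀ ↔ ∃ W, ∀ t < τ.C * τ.R, τ.Good t₀ v₀ W t := by
  simp only [Supported, reach_iff hb le_rfl]
  constructor
  · rintro ⟨_, _, W, hW, _⟩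
    exact ⟨W, hW⟩
  · rintro ⟨W, hW⟩
    exact ⟨_, code_lt hb le_rfl fun s hs => (hW s hs).1, W, hW, rfl⟩

end Tables

/-! ### Positions of the entries in the encoding -/

theorem length_flatMap_finRange {n k : ℕ} (f : Fin n → List ℕ) (hf : ∀ i, (f i).length = k) :
    ((List.finRange n).flatMap f).length = n * k := by
  simp [List.length_flatMap, hf]

theorem getD_flatMap_finRange {n k : ℕ} (f : Fin n → List ℕ) (hf : ∀ i, (f i).length = k)
    (i : Fin n) {j : ℕ} (hj : j < k) :
    ((List.finRange n).flatMap f).getD (k * i + j) 0 = (f i).getD j 0 := by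
  induction n with
  | zero => exact i.elim0
  | succ n ih =>
    rw [List.finRange_succ, List.flatMap_cons, List.flatMap_map]
    refine Fin.cases ?_ (fun i => ?_) i
    · rw [Fin.val_zero, mul_zero, zero_add, List.getD_append _ _ _ _ (by rw [hf]; exact hj)]
    · have e : k * (i.succ : ℕ) + j = (f 0).length + (k * i + j) := by
        rw [hf, Fin.val_succ]
        ring
      rw [e, List.getD_append_right _ _ _ _ (by omega), Nat.add_sub_cancel_left]
      exact ih (fun i => f i.succ) (fun i => hf _) i

theorem getD_map_finRange {n : ℕ} (f : Fin n → ℕ) (i : Fin n) :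
    ((List.finRange n).map f).getD i 0 = f i := by
  simp [List.getD]

section DFA

variable {d n : ℕ} (A : DFA (Fin d) (Fin n))

theorem length_encodeDFA : (encodeDFA A).length = d * n + n + 1 := by
  rw [encodeDFA, List.length_append, length_flatMap_finRange (k := d) _ (by simp)]
  simp
  ring

theorem encodeDFA_start : (encodeDFA A).getD 0 0 = A.start := by
  simp [encodeDFA]

theorem encodeDFA_accept (q : Fin n) : (encodeDFA A).getD (1 + q) 0 = bit (q ∈ A.accept) := by
  rw [encodeDFA, List.append_assoc, List.getD_append_right _ _ _ _ (by simp),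
    List.getD_append _ _ _ _ (by simp)]
  simp [List.getD]

theorem encodeDFA_step (q : Fin n) (v : Fin d) :
    (encodeDFA A).getD (1 + n + (d * q + v)) 0 = A.step q v := by
  rw [encodeDFA, List.getD_append_right _ _ _ _ (by simp; omega)]
  have e : 1 + n + (d * q + v) - ([(A.start : ℕ)] ++
      (List.finRange n).map (fun q => bit (q ∈ A.accept))).length = d * q + v := by
    simp
    omega
  rw [e, getD_flatMap_finRange _ (by simp) q v.2]
  exact getD_map_finRange (fun v => (A.step q v : ℕ)) v

end DFA

section Domains

variable {R C d : ℕ} (D : Domains R C d)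

theorem length_encodeDomains : (encodeDomains D).length = R * (C * d) := by
  rw [encodeDomains, length_flatMap_finRange (k := C * d)]
  intro r
  rw [length_flatMap_finRange (k := d)]
  simp

theorem mul_add_lt_mul {a b i j : ℕ} (hi : i < b) (hj : j < a) : a * i + j < a * b := by
  have := Nat.mul_le_mul_left a (Nat.succ_le_of_lt hi)
  rw [Nat.succ_eq_add_one, mul_add] at this
  omega

theorem encodeDomains_getD (r : Fin R) (c : Fin C) (v : Fin d) :
    (encodeDomains D).getD (d * (C * r + c) + v) 0 = bit (v ∈ D r c) := by
  have e : d * (C * r + c) + v = (C * d) * r + (d * c + v) := by ring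
  have h : d * (c : ℕ) + v < C * d := by
    rw [mul_comm C]
    exact mul_add_lt_mul c.2 v.2
  rw [e, encodeDomains, getD_flatMap_finRange (k := C * d) _ _ r h,
    getD_flatMap_finRange _ (by simp) c v.2]
  · exact getD_map_finRange (fun v => bit (v ∈ D r c)) v
  · intro r
    rw [length_flatMap_finRange (k := d)]
    simp

/-- Lists of domain bits are determined by their length and entries. -/
theorem eq_encodeDomains {l : List ℕ} (hl : l.length = R * (C * d))
    (h : ∀ (r : Fin R) (c : Fin C) (v : Fin d), l.getD (d * (C * r + c) + v) 0 = bit (v ∈ D r c)) :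
    l = encodeDomains D := by
  refine List.ext_getElem (by rw [hl, length_encodeDomains]) fun j h₁ h₂ => ?_
  rw [hl] at h₁
  have hd : 0 < d := Nat.pos_of_ne_zero fun h0 => by simp [h0] at h₁
  have hC : 0 < C := Nat.pos_of_ne_zero fun h0 => by simp [h0] at h₁
  have h3 : j / d / C < R := by
    rw [Nat.div_div_eq_div_mul]
    exact Nat.div_lt_of_lt_mul (by rw [mul_comm d, mul_comm]; exact h₁)
  have e : d * (C * (j / d / C) + j / d % C) + j % d = j := by
    rw [Nat.div_add_mod, Nat.div_add_mod]
  have k₁ := h ⟨_, h3⟩ ⟨_, Nat.mod_lt (j / d) hC⟩ ⟨_, Nat.mod_lt j hd⟩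
  have k₂ := encodeDomains_getD D ⟨_, h3⟩ ⟨_, Nat.mod_lt (j / d) hC⟩ ⟨_, Nat.mod_lt j hd⟩
  rw [← k₂] at k₁
  simp only [e] at k₁
  rwa [List.getD_eq_getElem _ _ (by rw [hl]; exact h₁), List.getD_eq_getElem _ _ h₂] at k₁

end Domains

namespace Instance

variable (I : Instance)

/-- The tables of an instance. -/
noncomputable def tables : Tables where
  R := I.R
  C := I.C
  d := I.d
  nQ := I.nQ
  nQ' := I.nQ'
  inp i := (encode I).getD i 0

theorem tables_reads : I.tables.Reads (encode I) :=
  ⟨fun _ => rfl, rfl, rfl, rfl, rfl, rfl⟩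

theorem inp_eq (i : ℕ) : I.tables.inp i = (encode I).getD i 0 := rfl

theorem length_rows :
    ((List.finRange I.R).flatMap fun r => encodeDFA (I.row r)).length = I.R * I.tables.rowLen :=
  length_flatMap_finRange _ fun _ => length_encodeDFA _

theorem length_cols :
    ((List.finRange I.C).flatMap fun c => encodeDFA (I.col c)).length = I.C * I.tables.colLen :=
  length_flatMap_finRange _ fun _ => length_encodeDFA _

theorem length_encode : (encode I).length =
    5 + I.R * I.tables.rowLen + I.C * I.tables.colLen + I.R * (I.C * I.d) := by
  rw [encode, List.length_append, List.length_append, List.length_append, length_rows, length_cols,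
    length_encodeDomains]
  rfl

theorem inp_row (r : Fin I.R) {j : ℕ} (hj : j < I.tables.rowLen) :
    I.tables.inp (I.tables.rowBase r + j) = (encodeDFA (I.row r)).getD j 0 := by
  have h := mul_add_lt_mul r.2 hj
  have e : I.tables.rowBase r + j = 5 + (I.tables.rowLen * r + j) := by
    rw [Tables.rowBase]
    ring
  rw [e, inp_eq, encode, List.append_assoc, List.append_assoc,
    List.getD_append_right _ _ _ _ (by simp), List.length_cons, List.length_cons, List.length_cons,
    List.length_cons, List.length_cons, List.length_nil, Nat.add_sub_cancel_left,
    List.getD_append _ _ _ _ (by rw [length_rows, mul_comm I.R]; exact h)]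
  exact getD_flatMap_finRange _ (fun _ => length_encodeDFA _) r hj

theorem inp_col (c : Fin I.C) {j : ℕ} (hj : j < I.tables.colLen) :
    I.tables.inp (I.tables.colBase c + j) = (encodeDFA (I.col c)).getD j 0 := by
  have h := mul_add_lt_mul c.2 hj
  have e : I.tables.colBase c + j = ([I.R, I.C, I.d, I.nQ, I.nQ'] ++
      (List.finRange I.R).flatMap (fun r => encodeDFA (I.row r))).length +
        (I.tables.colLen * c + j) := by
    rw [Tables.colBase, Tables.colOff, List.length_append, length_rows]
    change _ + (I.R * _ + 5) + j = 5 + _ + _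
    ring
  rw [e, inp_eq, encode, List.append_assoc, List.getD_append_right _ _ _ _ (by simp),
    Nat.add_sub_cancel_left,
    List.getD_append _ _ _ _ (by rw [length_cols, mul_comm I.C]; exact h)]
  exact getD_flatMap_finRange _ (fun _ => length_encodeDFA _) c hj

theorem domBit_eq (r : Fin I.R) (c : Fin I.C) (v : Fin I.d) :
    I.tables.domBit (I.C * r + c) v = bit (v ∈ I.dom r c) := by
  have e : I.tables.domOff + I.tables.d * (I.C * r + c) + v =
      ([I.R, I.C, I.d, I.nQ, I.nQ'] ++
      (List.finRange I.R).flatMap (fun r => encodeDFA (I.row r)) ++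
      (List.finRange I.C).flatMap (fun c => encodeDFA (I.col c))).length +
        (I.d * (I.C * r + c) + v) := by
    rw [Tables.domOff, Tables.colOff, List.length_append, List.length_append, length_rows,
      length_cols]
    change I.C * _ + (I.R * _ + 5) + I.d * _ + _ = 5 + _ + _ + _
    ring
  rw [Tables.domBit, e, inp_eq, encode, List.getD_append_right _ _ _ _ (by simp),
    Nat.add_sub_cancel_left]
  exact encodeDomains_getD _ r c v

theorem rowStart_eq (r : Fin I.R) : I.tables.rowStart r = (I.row r).start := by
  rw [← encodeDFA_start, ← I.inp_row r (Nat.succ_pos _)]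
  rfl

theorem rowAccept_eq (r : Fin I.R) (q : Fin I.nQ) :
    I.tables.rowAccept r q = bit (q ∈ (I.row r).accept) := by
  have := q.2
  rw [← encodeDFA_accept, ← I.inp_row r, Tables.rowAccept, add_assoc]
  change _ < I.d * I.nQ + I.nQ + 1
  omega

theorem rowStep_eq (r : Fin I.R) (q : Fin I.nQ) (v : Fin I.d) :
    I.tables.rowStep r q v = (I.row r).step q v := by
  have := mul_add_lt_mul q.2 v.2
  rw [← encodeDFA_step, ← I.inp_row r, Tables.rowStep]
  · simp only [add_assoc]
    rfl
  · change _ < I.d * I.nQ + I.nQ + 1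
    omega

theorem colStart_eq (c : Fin I.C) : I.tables.colStart c = (I.col c).start := by
  rw [← encodeDFA_start, ← I.inp_col c (Nat.succ_pos _)]
  rfl

theorem colAccept_eq (c : Fin I.C) (q : Fin I.nQ') :
    I.tables.colAccept c q = bit (q ∈ (I.col c).accept) := by
  have := q.2
  rw [← encodeDFA_accept, ← I.inp_col c, Tables.colAccept, add_assoc]
  change _ < I.d * I.nQ' + I.nQ' + 1
  omega

theorem colStep_eq (c : Fin I.C) (q : Fin I.nQ') (v : Fin I.d) :
    I.tables.colStep c q v = (I.col c).step q v := by
  have := mul_add_lt_mul q.2 v.2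
  rw [← encodeDFA_step, ← I.inp_col c, Tables.colStep]
  · simp only [add_assoc]
    rfl
  · change _ < I.d * I.nQ' + I.nQ' + 1
    omega

theorem tables_bounded (hR : 0 < I.R) (hC : 0 < I.C) : I.tables.Bounded where
  pos_C := hC
  pos_nQ := (I.row ⟨0, hR⟩).start.pos
  pos_nQ' := (I.col ⟨0, hC⟩).start.pos
  rowStart_lt r hr := (I.rowStart_eq ⟨r, hr⟩).trans_lt (Fin.is_lt _)
  rowStep_lt r hr q hq v hv := (I.rowStep_eq ⟨r, hr⟩ ⟨q, hq⟩ ⟨v, hv⟩).trans_lt (Fin.is_lt _)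
  colStart_lt c hc := (I.colStart_eq ⟨c, hc⟩).trans_lt (Fin.is_lt _)
  colStep_lt c hc q hq v hv := (I.colStep_eq ⟨c, hc⟩ ⟨q, hq⟩ ⟨v, hv⟩).trans_lt (Fin.is_lt _)

/-! ### Good assignments of cells are satisfying assignments of the matrix -/

variable {I} {M : Fin I.R → Fin I.C → Fin I.d} {W : ℕ → ℕ}

/-- The case distinction is needed because, before column 0, `rowState` still holds the final state
of the previous row or the placeholder. -/
theorem rowState_eq (hW : ∀ (r : Fin I.R) (c : Fin I.C), W (I.C * r + c) = M r c)
    (r : Fin I.R) (c : ℕ) (hc : c ≤ I.C) :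
    (if c = 0 then I.tables.rowStart r else I.tables.rowState W (I.C * r + c)) =
      (I.row r).eval (List.ofFn fun i : Fin c => M r (i.castLE hc)) := by
  induction c with
  | zero => simp [rowStart_eq]
  | succ c ih =>
    have hc' : c < I.C := hc
    rw [if_neg (by omega), ← add_assoc, Tables.rowState]
    change I.tables.rowNext ((I.C * r + c) / I.C) ((I.C * r + c) % I.C) _ _ = _
    rw [Nat.mul_add_mod, Nat.mod_eq_of_lt hc', Nat.mul_add_div (by omega), Nat.div_eq_of_lt hc',
      add_zero, Tables.rowNext, ih (by omega), hW r ⟨c, hc'⟩, rowStep_eq, List.ofFn_succ',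
      List.concat_eq_append, DFA.eval_append_singleton]
    rfl

theorem colState_eq (hW : ∀ (r : Fin I.R) (c : Fin I.C), W (I.C * r + c) = M r c)
    (c : Fin I.C) (r : ℕ) (hr : r ≤ I.R) :
    (if r = 0 then I.tables.colStart c else I.tables.colState W c r) =
      (I.col c).eval (List.ofFn fun i : Fin r => M (i.castLE hr) c) := by
  induction r with
  | zero => simp [colStart_eq]
  | succ r ih =>
    have hr' : r < I.R := hr
    rw [if_neg (by omega), Tables.colState]
    change I.tables.colNext r c _ (W (I.C * r + c)) = _
    rw [Tables.colNext, ih (by omega), hW ⟨r, hr'⟩ c, colStep_eq, List.ofFn_succ',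
      List.concat_eq_append, DFA.eval_append_singleton]
    rfl

theorem bit_ne_zero {P : Prop} : bit P ≠ 0 ↔ P := by
  simp [bit]

/-- The assignments that pass all local tests are the solutions with a prescribed value. -/
theorem forall_good_iff (hR : 0 < I.R) (hC : 0 < I.C)
    (hW : ∀ (r : Fin I.R) (c : Fin I.C), W (I.C * r + c) = M r c)
    (r₀ : Fin I.R) (c₀ : Fin I.C) (v₀ : Fin I.d) :
    (∀ t < I.C * I.R, I.tables.Good (I.C * r₀ + c₀) v₀ W t) ↔
      (∀ r c, M r c ∈ I.dom r c) ∧ I.Satisfies M ∧ M r₀ c₀ = v₀ := by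
  have hrow (r : Fin I.R) : I.tables.rowAccept r (I.tables.rowState W (I.C * r + I.C)) ≠ 0 ↔
      List.ofFn (fun c => M r c) ∈ (I.row r).accepts := by
    have := rowState_eq hW r I.C le_rfl
    rw [if_neg hC.ne'] at this
    rw [this, rowAccept_eq, bit_ne_zero]
    rfl
  have hcol (c : Fin I.C) : I.tables.colAccept c (I.tables.colState W c I.R) ≠ 0 ↔
      List.ofFn (fun r => M r c) ∈ (I.col c).accepts := by
    have := colState_eq hW c I.R le_rfl
    rw [if_neg hR.ne'] at this
    rw [this, colAccept_eq, bit_ne_zero]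
    rfl
  have hgood (r : Fin I.R) (c : Fin I.C) :
      I.tables.Good (I.C * r₀ + c₀) v₀ W (I.C * r + c) ↔
        M r c ∈ I.dom r c ∧ (r = r₀ → c = c₀ → M r c = v₀) ∧
        ((c : ℕ) = I.C - 1 → List.ofFn (fun c => M r c) ∈ (I.row r).accepts) ∧
        ((r : ℕ) = I.R - 1 → List.ofFn (fun r => M r c) ∈ (I.col c).accepts) := by
    have e₁ : (I.C * r + c) / I.tables.C = r := by
      change (I.C * r + c) / I.C = r
      rw [Nat.mul_add_div hC, Nat.div_eq_of_lt c.2, add_zero]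
    have e₂ : (I.C * r + c) % I.tables.C = c := by
      change (I.C * r + c) % I.C = c
      rw [Nat.mul_add_mod, Nat.mod_eq_of_lt c.2]
    have e₃ : I.tables.cellState W (I.C * r + c + I.tables.C) = I.tables.colState W c (r + 1) := by
      rw [Tables.cellState, Nat.add_mod_right, Nat.add_div_right _ (show 0 < I.tables.C from hC),
        e₁, e₂]
    have e₄ : W (I.C * r + c) < I.tables.d := by
      rw [hW]
      exact Fin.is_lt _
    have e₅ : I.C * (r : ℕ) + c = I.C * r₀ + c₀ ↔ r = r₀ ∧ c = c₀ := by
      refine ⟨fun h => ?_, by rintro ⟨rfl, rfl⟩; rfl⟩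
      have := Tables.eq_of_mul_add_eq c.2 c₀.2 h
      exact ⟨Fin.ext this.1, Fin.ext this.2⟩
    rw [Tables.Good, Tables.Allowed, e₁, e₂, e₃, and_iff_right e₄, hW]
    change I.tables.domBit (I.C * r + c) _ ≠ 0 ∧ (I.C * (r : ℕ) + c = _ → _) ∧
      ((c : ℕ) = I.C - 1 → _) ∧ ((r : ℕ) = I.R - 1 → _) ↔ _
    rw [domBit_eq, bit_ne_zero, e₅, and_imp, ← Fin.ext_iff]
    refine and_congr_right fun _ => and_congr_right fun _ => and_congr
      (imp_congr_right fun hc => ?_) (imp_congr_right fun hr => ?_)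
    · rw [← hrow, add_assoc, hc, Nat.sub_add_cancel hC]
    · rw [← hcol, hr, Nat.sub_add_cancel hR]
  constructor
  · intro h
    -- Acceptance of a row is read off its last cell, and acceptance of a column off its bottom
    -- cell.
    have h' (r : Fin I.R) (c : Fin I.C) := (hgood r c).1 (h _ (mul_add_lt_mul r.2 c.2))
    exact ⟨fun r c => (h' r c).1, ⟨fun r => (h' r ⟨I.C - 1, by omega⟩).2.2.1 rfl,
      fun c => (h' ⟨I.R - 1, by omega⟩ c).2.2.2 rfl⟩, (h' r₀ c₀).2.1 rfl rfl⟩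
  · rintro ⟨hdom, ⟨hrows, hcols⟩, hv⟩ t ht
    have := (hgood ⟨t / I.C, Nat.div_lt_of_lt_mul ht⟩ ⟨t % I.C, Nat.mod_lt _ hC⟩).2
      ⟨hdom _ _, by rintro rfl rfl; exact hv, fun _ => hrows _, fun _ => hcols _⟩
    simpa only [Nat.div_add_mod] using this

theorem supported_iff (hR : 0 < I.R) (hC : 0 < I.C) (r₀ : Fin I.R) (c₀ : Fin I.C) (v₀ : Fin I.d) :
    I.tables.Supported (I.C * r₀ + c₀) v₀ ↔
      ∃ M : Fin I.R → Fin I.C → Fin I.d,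
        (∀ r c, M r c ∈ I.dom r c) ∧ I.Satisfies M ∧ M r₀ c₀ = v₀ := by
  rw [Tables.supported_iff (I.tables_bounded hR hC)]
  constructor
  · rintro ⟨W, hW⟩
    exact ⟨fun r c => ⟨W (I.C * r + c), (hW _ (mul_add_lt_mul r.2 c.2)).1⟩,
      (forall_good_iff hR hC (fun _ _ => rfl) r₀ c₀ v₀).1 hW⟩
  · rintro ⟨M, hM⟩
    -- The value 0 outside the matrix is arbitrary: only cells below `C * R` are tested.
    refine ⟨fun t => if h : t < I.C * I.R then
      M ⟨t / I.C, Nat.div_lt_of_lt_mul h⟩ ⟨t % I.C, Nat.mod_lt _ hC⟩ else 0,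
      (forall_good_iff (M := M) hR hC (fun r c => ?_) r₀ c₀ v₀).2 hM⟩
    have e₁ : (I.C * r + c) / I.C = r := by
      rw [Nat.mul_add_div hC, Nat.div_eq_of_lt c.2, add_zero]
    have e₂ : (I.C * r + c) % I.C = c := by
      rw [Nat.mul_add_mod, Nat.mod_eq_of_lt c.2]
    rw [dif_pos (mul_add_lt_mul r.2 c.2)]
    simp only [e₁, e₂]

/-! ### The largest domain consistent subdomains -/

open Classical in
/-- The values that have a support. -/
noncomputable def supportedDomains (I : Instance) : Domains I.R I.C I.d := fun r c =>
  Finset.univ.filter fun v => ∃ M : Fin I.R → Fin I.C → Fin I.d,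
    (∀ r' c', M r' c' ∈ I.dom r' c') ∧ I.Satisfies M ∧ M r c = v

theorem mem_supportedDomains {r : Fin I.R} {c : Fin I.C} {v : Fin I.d} :
    v ∈ I.supportedDomains r c ↔ ∃ M : Fin I.R → Fin I.C → Fin I.d,
      (∀ r' c', M r' c' ∈ I.dom r' c') ∧ I.Satisfies M ∧ M r c = v := by
  simp [supportedDomains]

/-- A support `M` supports all of its own entries, so it survives when the unsupported values are
removed. Maximality holds because a support within smaller domains is one within `dom`. -/
theorem isEnforcedDC_supportedDomains (I : Instance) : I.IsEnforcedDC I.supportedDomains := by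
  refine ⟨⟨fun r c v hv => ?_, fun r c v hv => ?_⟩, fun D hD r c v hv => ?_⟩
  · obtain ⟨M, hM, -, rfl⟩ := mem_supportedDomains.1 hv
    exact hM r c
  · obtain ⟨M, hM, hS, hv⟩ := mem_supportedDomains.1 hv
    exact ⟨M, fun r' c' => mem_supportedDomains.2 ⟨M, hM, hS, rfl⟩, hS, hv⟩
  · obtain ⟨M, hM, hS, hv⟩ := hD.2 r c v hv
    exact mem_supportedDomains.2 ⟨M, fun r' c' => hD.1 r' c' (hM r' c'), hS, hv⟩

theorem enforcesDC_of_eq {l : List ℕ} (h : l = encodeDomains I.supportedDomains) :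
    EnforcesDC I l :=
  ⟨_, I.isEnforcedDC_supportedDomains, h⟩

/-! ### Running time in terms of the parameter, and the conclusion -/

/-- Start states give `nQ, nQ' ≥ 1`. The logarithm is therefore nonnegative, and the factor `nQ` of
the parameter can be dropped. -/
theorem power_le_two_pow_param (hR : 0 < I.R) (hC : 0 < I.C) : I.nQ' ^ I.C ≤ 2 ^ I.param := by
  have hq : 1 ≤ (I.nQ : ℝ) := by exact_mod_cast (I.row ⟨0, hR⟩).start.pos
  have hq' : 0 < (I.nQ' : ℝ) := by exact_mod_cast (I.col ⟨0, hC⟩).start.pos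
  have hlog : 0 ≤ Real.logb 2 I.nQ' :=
    Real.logb_nonneg (by norm_num) (by exact_mod_cast (I.col ⟨0, hC⟩).start.pos)
  have h1 : (I.C : ℝ) * Real.logb 2 I.nQ' ≤ I.param := by
    refine le_trans ?_ (Nat.le_ceil _)
    refine mul_le_mul_of_nonneg_right ?_ hlog
    exact le_mul_of_one_le_right (Nat.cast_nonneg _) hq
  have h2 : ((I.nQ' : ℝ)) ^ I.C ≤ 2 ^ I.param := by
    rw [← Real.rpow_natCast 2, ← Real.logb_le_iff_le_rpow (by norm_num) (by positivity),
      Real.logb_pow]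
    exact h1
  exact_mod_cast h2

theorem length_le_inputSize (l : List ℕ) : l.length ≤ inputSize l := by
  induction l with
  | nil => simp [inputSize]
  | cons a l ih =>
    simp only [inputSize, List.map_cons, List.sum_cons, List.length_cons] at ih ⊢
    omega

/-- The dimensions and code lengths are bounded by the number of entries of the input, since each
automaton is listed with all its states and transitions. Only `queues` and `size` need the factor `2
^ k`. -/
theorem tables_le (hR : 0 < I.R) (hC : 0 < I.C) :
    ∀ x ∈ [I.tables.R, I.tables.C, I.tables.d, I.tables.nQ, I.tables.nQ', I.tables.rowLen,
      I.tables.colLen, I.tables.queues, I.tables.size],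
      x ≤ 2 ^ I.param * inputSize (encode I) := by
  set n := inputSize (encode I) with hn
  have hlen := (length_le_inputSize (encode I)).trans_eq hn.symm
  rw [length_encode] at hlen
  have hb := I.tables_bounded hR hC
  have hq : 0 < I.nQ := hb.pos_nQ
  have hq' : 0 < I.nQ' := hb.pos_nQ'
  have hk := power_le_two_pow_param hR hC
  have hk1 : 1 ≤ 2 ^ I.param := Nat.one_le_two_pow
  have small {x : ℕ} (h : x ≤ n) : x ≤ 2 ^ I.param * n :=
    h.trans (Nat.le_mul_of_pos_left _ hk1)
  have hrow : I.tables.rowLen ≤ I.R * I.tables.rowLen := Nat.le_mul_of_pos_left _ hR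
  have hcol : I.tables.colLen ≤ I.C * I.tables.colLen := Nat.le_mul_of_pos_left _ hC
  have hR' : I.R ≤ I.R * I.tables.rowLen := Nat.le_mul_of_pos_right _ (Nat.succ_pos _)
  have hC' : I.C ≤ I.C * I.tables.colLen := Nat.le_mul_of_pos_right _ (Nat.succ_pos _)
  have hrl : I.tables.rowLen = I.d * I.nQ + I.nQ + 1 := rfl
  have hcl : I.tables.colLen = I.d * I.nQ' + I.nQ' + 1 := rfl
  have hd : I.d ≤ I.d * I.nQ := Nat.le_mul_of_pos_right _ hq
  have hpow : I.nQ' * I.nQ' ^ (I.C - 1) = I.nQ' ^ I.C := by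
    rw [← pow_succ', Nat.sub_add_cancel hC]
  have hP : I.tables.queues ≤ 2 ^ I.param :=
    (Nat.pow_le_pow_right hq' (Nat.sub_le _ _)).trans hk
  have hS : I.tables.size = I.nQ * I.nQ' ^ I.C := by
    rw [← hpow]
    rfl
  simp only [List.mem_cons, List.not_mem_nil, or_false, forall_eq_or_imp, forall_eq]
  refine ⟨small (x := I.R) (by omega), small (x := I.C) (by omega), small (x := I.d) (by omega),
    small (x := I.nQ) (by omega), small (x := I.nQ') (by omega), small (by omega),
    small (by omega), ?_, ?_⟩
  · exact hP.trans (Nat.le_mul_of_pos_right _ (by omega))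
  · rw [hS, mul_comm]
    exact Nat.mul_le_mul hk (by omega)

theorem exec_enforceDC_correct (I : Instance) :
    ∃ (t : ℕ) (s : State), Exec enforceDC (init (encode I)) t s ∧ EnforcesDC I (output s) ∧
      t ≤ totalWeight * (2 ^ I.param * inputSize (encode I) + 1) ^ Cmd.depth searches := by
  rcases Nat.eq_zero_or_pos I.R with hR | hR
  · obtain ⟨t, ht, s, he, ho⟩ := exec_enforceDC_of_eq_zero I.tables_reads (Or.inl hR)
    refine ⟨t, s, he, enforcesDC_of_eq ?_, ht.trans (Nat.le_mul_of_pos_right _ (by positivity))⟩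
    rw [ho, eq_comm, ← List.length_eq_zero_iff, length_encodeDomains, hR, zero_mul]
  rcases Nat.eq_zero_or_pos I.C with hC | hC
  · obtain ⟨t, ht, s, he, ho⟩ := exec_enforceDC_of_eq_zero I.tables_reads (Or.inr hC)
    refine ⟨t, s, he, enforcesDC_of_eq ?_, ht.trans (Nat.le_mul_of_pos_right _ (by positivity))⟩
    rw [ho, eq_comm, ← List.length_eq_zero_iff, length_encodeDomains, hC, zero_mul, mul_zero]
  obtain ⟨t, ht, s, he, hlen, hs⟩ :=
    exec_enforceDC I.tables_reads hR.ne' hC.ne' (tables_le hR hC)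
  refine ⟨t, s, he, enforcesDC_of_eq (eq_encodeDomains _ ?_ fun r c v => ?_), ht⟩
  · rw [output, List.length_map, List.length_range, hlen]
    rfl
  · have hlt : I.d * (I.C * r + c) + v < s.reg 0 := by
      rw [hlen]
      change _ < I.R * (I.C * I.d)
      have := mul_add_lt_mul (mul_add_lt_mul r.2 c.2) v.2
      calc _ < _ := this
        _ = _ := by ring
    have e : (output s).getD (I.d * (I.C * r + c) + v) 0 = s.arr 1 (I.d * (I.C * r + c) + v) := by
      simp [output, List.getD, hlt]
    have key : (∃ r' < I.tables.R, ∃ c' < I.tables.C, ∃ v' < I.tables.d,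
        I.tables.Supported (I.tables.C * r' + c') v' ∧
          I.d * (I.C * r + c) + v = I.tables.d * (I.tables.C * r' + c') + v') ↔
        v ∈ I.supportedDomains r c := by
      rw [mem_supportedDomains, ← supported_iff hR hC]
      constructor
      · rintro ⟨r', _, c', hc', v', hv', h, he⟩
        -- An output position determines the cell number and the value; as `Supported` refers only
        -- to these, `r'` and `c'` need not be compared with `r` and `c`.
        obtain ⟨h₁, h₂⟩ := Tables.eq_of_mul_add_eq v.2 hv' he
        rw [h₁, h₂]
        exact h
      · intro h
        exact ⟨r, r.2, c, c.2, v, v.2, h, rfl⟩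
    rw [e]
    have hs := hs (I.d * (I.C * r + c) + v)
    rw [key] at hs
    by_cases h : v ∈ I.supportedDomains r c
    · rw [hs.1 h, bit, if_pos h]
    · rw [hs.2 h, bit, if_neg h]

end Instance

end RegularSq

theorem theorem5 :
    RAM.FixedParameterTractable RegularSq.encode RegularSq.Instance.param
      RegularSq.EnforcesDC := by
  set D := RAM.Cmd.depth RegularSq.searches with hD
  -- The two factors come from `2 ^ k * n + 1 ≤ 2 ^ k * (n + 1)`, raised to the nesting depth `D`.
  refine ⟨RegularSq.enforceDC, fun k => (2 ^ k) ^ D,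
    Polynomial.C RegularSq.totalWeight * (Polynomial.X + 1) ^ D, ?_, fun I => ?_⟩
  · have h : Primrec₂ fun a b : ℕ => a ^ b := Primrec₂.unpaired'.1 Nat.Primrec.pow
    exact (h.comp (h.comp (Primrec.const 2) Primrec.id) (Primrec.const D)).to_comp
  · obtain ⟨t, s, he, hs, ht⟩ := I.exec_enforceDC_correct
    refine ⟨t, s, he, hs, ht.trans ?_⟩
    simp only [Polynomial.eval_mul, Polynomial.eval_C, Polynomial.eval_pow, Polynomial.eval_add,
      Polynomial.eval_X, Polynomial.eval_one, ← hD]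
    rw [mul_left_comm, ← mul_pow]
    refine Nat.mul_le_mul_left _ (Nat.pow_le_pow_left ?_ _)
    have : 1 ≤ 2 ^ I.param := Nat.one_le_two_pow
    rw [mul_add]
    omega
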